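/- **Conventions.** All Lie algebras are real, of arbitrary dimension, carry a locally convex vector space topology and have a continuous bracket; homomorphisms and linear maps between them are continuous. A sequence $0\to\mathfrak a\xrightarrow{i}\mathfrak b\xrightarrow{r}\mathfrak c\to 0$ of such Lie algebras is called *short exact* if $i$ is a topological embedding with image $\ker r$ and $r$ has a continuous linear section. A *central crossed module* $\mathfrak G=(\mathfrak h\xrightarrow{t}\mathfrak g\xrightarrow{\alpha}\mathrm{Der}(\mathfrak h))$ consists of Lie algebra homomorphisms $t$ and $\alpha$ (with $(X,y)\mapsto\alpha(X,y)$ continuous) such that $t\,\alpha(X,y)=[X,ty]$ and $\alpha(tx,y)=[x,y]$, such that $\alpha(X,y)=0$ whenever $ty=0$, and such that $\ker t\subseteq\mathfrak h$ and $t\mathfrak h\subseteq\mathfrak g$ are topologically complemented. Put $\mathfrak f=\mathfrak g/t\mathfrak h$ with projection $p:\mathfrak g\to\mathfrak f$. A *section* of $\mathfrak G$ is a continuous linear map $s:\mathfrak f\to\mathfrak g$ with $ps=\mathrm{id}$. **Groupoids.** The groupoid $\mathrm{Adj}(\mathfrak G)$ has as objects the pairs $(s,\eta)$ of a section $s$ and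 a continuous bilinear map $\eta:\mathfrak g\times\mathfrak g\to\mathfrak h$ such that $$\eta([X,Y],Z)+\eta(Y,[X,Z])=\eta(X,[Y,Z]),\quad \eta(tx,Y)=-\alpha(Y,x),\quad \eta(X,ty)=\alpha(X,y),\quad t\,\eta(X,Y)=[X,Y]-s\,p[X,Y].$$ A morphism $(s,\eta)\to(s',\eta')$ is a continuous linear map $\phi:\mathfrak f\to\mathfrak h$ with $s'-s=t\phi$ and $\eta'-\eta=\delta(p^*\phi)$, where $\delta(p^*\phi)(X,Y)=-\phi(p[X,Y])$; composition is addition. **The bicategory $\mathfrak{CrMod}^{\mathrm{sec}}$.** Its objects are the central crossed modules. A *butterfly* $\mathfrak k:\mathfrak G_1\to\mathfrak G_2$ is a Lie algebra $\mathfrak k$ with homomorphisms $i_1:\mathfrak h_1\to\mathfrak k$, $i_2:\mathfrak h_2\to\mathfrak k$, $r_1:\mathfrak k\to\mathfrak g_1$, $r_2:\mathfrak k\to\mathfrak g_2$ such that $r_1i_1=t_1$, $r_2i_2=t_2$, $r_2i_1=0$, $0\to\mathfrak h_2\xrightarrow{i_2}\mathfrak k\xrightarrow{r_1}\mathfrak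 g_1\to0$ is short exact, and $i_1\alpha_1(r_1x,y)=[x,i_1y]$, $i_2\alpha_2(r_2x,y)=[x,i_2y]$. It is *invertible* if $0\to\mathfrak h_1\xrightarrow{i_1}\mathfrak k\xrightarrow{r_2}\mathfrak g_2\to0$ is short exact, too. The 1-morphisms of $\mathfrak{CrMod}^{\mathrm{sec}}$ are pairs $(\mathfrak k,q)$ of an invertible butterfly and a continuous linear section $q$ of $r_1$; the 2-morphisms $(\mathfrak k,q)\to(\mathfrak k',q')$ are all homomorphisms $\mathfrak k\to\mathfrak k'$ that commute with $i_1,i_2,r_1,r_2$ (no compatibility with $q,q'$ is required). The composition of $(\mathfrak k,q):\mathfrak G_1\to\mathfrak G_2$ and $(\mathfrak k',q'):\mathfrak G_2\to\mathfrak G_3$ is $(\mathfrak k\times_{\mathfrak g_2}\mathfrak k')/\mathfrak h_2$, where $\mathfrak h_2$ is embedded by $y\mapsto(i_2y,i_2'y)$ with $i_2':\mathfrak h_2\to\mathfrak k'$ the map belonging to $\mathfrak k'$, with the induced maps and the section $X\mapsto[qX,\,q'r_2qX]$. The identity of $\mathfrak G$ is the semi-direct sum $\mathfrak h\rtimes\mathfrak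 g$ with $i_1y=(-y,ty)$, $i_2y=(y,0)$, $r_1(y,X)=X$, $r_2(y,X)=ty+X$ and the section $X\mapsto(0,X)$. **The functors.** Let $(\mathfrak k,q):\mathfrak G_1\to\mathfrak G_2$ be a 1-morphism. Let $j:\mathfrak k\to\mathfrak h_2$ be determined by $i_2j+qr_1=\mathrm{id}$, and put $\phi_q=r_2q$, $f_q=-j\,i_1$, $\lambda_q(X,Y)=j[qX,qY]$; let $\Phi:\mathfrak f_1\to\mathfrak f_2$ be the isomorphism induced by $\phi_q$. For a section $s$ and a linear map $u:\mathfrak g\to\mathfrak h$ with $tu=\mathrm{id}-sp$ put $$\omega_u(X,Y)=\alpha(X,uY)-\alpha(Y,uX)-[uX,uY]+u[spX,spY].$$ On objects, $\mathrm{Adj}^q(\mathfrak k)(s_1,\eta_1)=(s_2,\eta_2)$ with $$s_2=\phi_q s_1\Phi^{-1},\qquad \eta_2=\omega_{u_2}+p_2^*(\Phi^{-1})^*\big(f_q\beta-R_q\big),$$ where $u_1,u_2$ are any such maps for $s_1,s_2$, and $\beta,R_q$ are the bilinear maps on $\mathfrak f_1$ with $p_1^*\beta=\eta_1-\omega_{u_1}$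 and $p_1^*R_q=\phi_q^*\omega_{u_2}-f_q\omega_{u_1}-\lambda_q$ (the result does not depend on $u_1,u_2$). On morphisms, $\mathrm{Adj}^q(\mathfrak k)(\phi)=f_q\,\phi\,\Phi^{-1}$. For a 2-morphism $\sigma:(\mathfrak k,q)\to(\mathfrak k',q')$ let $\gamma:\mathfrak g_1\to\mathfrak h_2$ be the continuous linear map with $q'-\sigma q=i_2'\gamma$, where now $i_2':\mathfrak h_2\to\mathfrak k'$ denotes the map $i_2$ of the butterfly $\mathfrak k'$; the natural isomorphism $\mathrm{Adj}^q(\mathfrak k)\Rightarrow\mathrm{Adj}^{q'}(\mathfrak k')$ assigned to $\sigma$ has the component $\gamma\,s\,\Phi^{-1}$ at $(s,\eta)$. **Theorem.** The groupoids $\mathrm{Adj}(\mathfrak G)$, the functors $\mathrm{Adj}^q(\mathfrak k)$ and the natural isomorphisms assigned to the morphisms of butterflies form a strict 2-functor $\mathfrak{CrMod}^{\mathrm{sec}}\to\mathfrak{Grpd}$ to the strict 2-category of groupoids, functors and natural transformations; that is, they are the data of a pseudofunctor that preserves identities and composition of 1-morphisms strictly, with identity coherence 2-morphisms. In particular, if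 $\mathfrak G_1$ and $\mathfrak G_2$ are weakly equivalent, i.e. if there exists an invertible butterfly $\mathfrak G_1\to\mathfrak G_2$, then the groupoids $\mathrm{Adj}(\mathfrak G_1)$ and $\mathrm{Adj}(\mathfrak G_2)$ are equivalent. -/

import Mathlib

open CategoryTheory Topology

universe u

/-! ### Locally convex Lie algebras -/

/-- A real Lie algebra (of arbitrary dimension) with a locally convex vector space topology for
which the bracket is (jointly) continuous. -/
structure LCLieAlg : Type (u + 1) where
  carrier : Type u
  [lieRing : LieRing carrier]
  [lieAlgebra : LieAlgebra ℝ carrier]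
  [topology : TopologicalSpace carrier]
  [isTopologicalAddGroup : IsTopologicalAddGroup carrier]
  [continuousSMul : ContinuousSMul ℝ carrier]
  [locallyConvex : LocallyConvexSpace ℝ carrier]
  continuous_lie : Continuous fun x : carrier × carrier => ⁅x.1, x.2⁆

namespace LCLieAlg

instance : CoeSort LCLieAlg.{u} (Type u) := ⟨LCLieAlg.carrier⟩

attribute [instance] lieRing lieAlgebra topology isTopologicalAddGroup continuousSMul locallyConvex

/-- The product of two locally convex Lie algebras, with componentwise bracket. -/
def prod (L M : LCLieAlg.{u}) : LCLieAlg.{u} where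
  carrier := L × M
  continuous_lie := by
    refine Continuous.prodMk ?_ ?_
    · exact L.continuous_lie.comp (f := fun x : (L × M) × (L × M) => (x.1.1, x.2.1))
        (by fun_prop)
    · exact M.continuous_lie.comp (f := fun x : (L × M) × (L × M) => (x.1.2, x.2.2))
        (by fun_prop)

/-- A Lie subalgebra with the subspace topology. -/
def sub (L : LCLieAlg.{u}) (S : LieSubalgebra ℝ L) : LCLieAlg.{u} where
  carrier := S
  isTopologicalAddGroup := inferInstanceAs (IsTopologicalAddGroup S.toSubmodule)
  continuousSMul := inferInstanceAs (ContinuousSMul ℝ S.toSubmodule)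
  locallyConvex := inferInstanceAs (LocallyConvexSpace ℝ S.toSubmodule)
  continuous_lie := by
    refine Continuous.subtype_mk (p := fun x => x ∈ S)
      (f := fun x : S × S => ⁅(x.1 : L), (x.2 : L)⁆) ?_ _
    exact L.continuous_lie.comp (f := fun x : S × S => ((x.1 : L), (x.2 : L))) (by fun_prop)

theorem locallyConvexSpace_quotient (E : Type u) [AddCommGroup E] [Module ℝ E]
    [TopologicalSpace E] [IsTopologicalAddGroup E] [ContinuousSMul ℝ E] [LocallyConvexSpace ℝ E]
    (S : Submodule ℝ E) : LocallyConvexSpace ℝ (E ⧸ S) := by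
  rw [locallyConvexSpace_iff_exists_convex_subset_zero]
  intro U hU
  have h0 : S.mkQ ⁻¹' U ∈ 𝓝 (0 : E) :=
    S.continuous_mkQ.continuousAt.preimage_mem_nhds (by simpa using hU)
  obtain ⟨V, hV, hVc, hVU⟩ :=
    (locallyConvexSpace_iff_exists_convex_subset_zero ℝ E).1 inferInstance _ h0
  refine ⟨S.mkQ '' V, ?_, hVc.linear_image S.mkQ, Set.image_subset_iff.2 hVU⟩
  simpa using S.isOpenMap_mkQ.image_mem_nhds hV

/-- The quotient of a locally convex Lie algebra by an ideal, with the quotient topology. -/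
def quot (L : LCLieAlg.{u}) (I : LieIdeal ℝ L) : LCLieAlg.{u} where
  carrier := L ⧸ I
  topology := inferInstanceAs (TopologicalSpace (L ⧸ I.toSubmodule))
  isTopologicalAddGroup := inferInstanceAs (IsTopologicalAddGroup (L ⧸ I.toSubmodule))
  continuousSMul := inferInstanceAs (ContinuousSMul ℝ (L ⧸ I.toSubmodule))
  locallyConvex := locallyConvexSpace_quotient L I.toSubmodule
  continuous_lie := by
    let : TopologicalSpace (L ⧸ I) := inferInstanceAs (TopologicalSpace (L ⧸ I.toSubmodule))
    have h := I.toSubmodule.isOpenQuotientMap_mkQ.prodMap I.toSubmodule.isOpenQuotientMap_mkQ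
    refine h.continuous_comp_iff.1 ?_
    exact I.toSubmodule.continuous_mkQ.comp L.continuous_lie

end LCLieAlg

/-- Continuous homomorphisms of locally convex Lie algebras. -/
structure LCLieHom (L M : LCLieAlg.{u}) extends L →ₗ⁅ℝ⁆ M where
  cont : Continuous toFun

namespace LCLieHom

variable {L M N : LCLieAlg.{u}}

instance : FunLike (LCLieHom L M) L M where
  coe f := f.toFun
  coe_injective f g h := by
    rcases f with ⟨⟨⟨⟨f, _⟩, _⟩, _⟩, _⟩
    rcases g with ⟨⟨⟨⟨g, _⟩, _⟩, _⟩, _⟩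
    obtain rfl : f = g := h
    rfl

instance : ContinuousLinearMapClass (LCLieHom L M) ℝ L M where
  map_add f := f.map_add'
  map_smulₛₗ f := f.map_smul'
  map_continuous f := f.cont

@[ext] theorem ext {f g : LCLieHom L M} (h : ∀ x, f x = g x) : f = g := DFunLike.ext _ _ h

theorem map_lie (f : LCLieHom L M) (x y : L) : f ⁅x, y⁆ = ⁅f x, f y⁆ := f.map_lie'

@[fun_prop] theorem continuous (f : LCLieHom L M) : Continuous f := f.cont

/-- The underlying continuous linear map. -/
def toCLM (f : LCLieHom L M) : L →L[ℝ] M := ⟨f.toLinearMap, f.cont⟩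

@[simp] theorem toCLM_apply (f : LCLieHom L M) (x : L) : f.toCLM x = f x := rfl

/-- A continuous linear map that preserves brackets. -/
def ofCLM (f : L →L[ℝ] M) (h : ∀ x y, f ⁅x, y⁆ = ⁅f x, f y⁆) : LCLieHom L M :=
  ⟨⟨f.toLinearMap, fun {x y} => h x y⟩, f.cont⟩

@[simp] theorem ofCLM_apply (f : L →L[ℝ] M) (h : ∀ x y, f ⁅x, y⁆ = ⁅f x, f y⁆) (x : L) :
    ofCLM f h x = f x := rfl

/-- The identity. -/
def id (L : LCLieAlg.{u}) : LCLieHom L L := ofCLM (ContinuousLinearMap.id ℝ L) fun _ _ => rfl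

@[simp] theorem id_apply (x : L) : id L x = x := rfl

/-- Composition. -/
def comp (g : LCLieHom M N) (f : LCLieHom L M) : LCLieHom L N :=
  ofCLM (g.toCLM.comp f.toCLM) fun x y => by simp [map_lie]

@[simp] theorem comp_apply (g : LCLieHom M N) (f : LCLieHom L M) (x : L) :
    g.comp f x = g (f x) := rfl

end LCLieHom

namespace LCLieHom

variable {L M N : LCLieAlg.{u}}

/-- The first projection of a product. -/
def fst (L M : LCLieAlg.{u}) : LCLieHom (L.prod M) L :=
  ⟨LieHom.fst ℝ L M, continuous_fst⟩

/-- The second projection of a product. -/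
def snd (L M : LCLieAlg.{u}) : LCLieHom (L.prod M) M :=
  ⟨LieHom.snd ℝ L M, continuous_snd⟩

/-- The inclusion of a Lie subalgebra. -/
def subtype (L : LCLieAlg.{u}) (S : LieSubalgebra ℝ L) : LCLieHom (L.sub S) L :=
  ⟨S.incl, continuous_subtype_val⟩

/-- The projection onto a quotient. -/
def proj (L : LCLieAlg.{u}) (I : LieIdeal ℝ L) : LCLieHom L (L.quot I) :=
  ⟨⟨I.toSubmodule.mkQ, rfl⟩, I.toSubmodule.continuous_mkQ⟩

theorem proj_surjective {L : LCLieAlg.{u}} {I : LieIdeal ℝ L} (x : L.quot I) : ∃ y, proj L I y = x :=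
  I.toSubmodule.mkQ_surjective x

theorem proj_eq_zero {L : LCLieAlg.{u}} {I : LieIdeal ℝ L} {x : L} : proj L I x = 0 ↔ x ∈ I :=
  Submodule.Quotient.mk_eq_zero I.toSubmodule

/-- The continuous linear map on a quotient induced by a continuous linear map. -/
def liftL {L M : LCLieAlg.{u}} {I : LieIdeal ℝ L} (φ : L →L[ℝ] M) (hφ : ∀ x ∈ I, φ x = 0) :
    L.quot I →L[ℝ] M :=
  Submodule.liftQL I.toSubmodule φ hφ

@[simp] theorem liftL_proj {L M : LCLieAlg.{u}} {I : LieIdeal ℝ L} (φ : L →L[ℝ] M)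
    (hφ : ∀ x ∈ I, φ x = 0) (x : L) : liftL φ hφ (proj L I x) = φ x := rfl

/-- The homomorphism on a quotient induced by a homomorphism. -/
def lift {L M : LCLieAlg.{u}} {I : LieIdeal ℝ L} (φ : LCLieHom L M) (hφ : ∀ x ∈ I, φ x = 0) :
    LCLieHom (L.quot I) M :=
  ofCLM (liftL φ.toCLM hφ) fun x y => by
    obtain ⟨x, rfl⟩ := proj_surjective x
    obtain ⟨y, rfl⟩ := proj_surjective y
    exact φ.map_lie x y

@[simp] theorem lift_proj {L M : LCLieAlg.{u}} {I : LieIdeal ℝ L} (φ : LCLieHom L M)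
    (hφ : ∀ x ∈ I, φ x = 0) (x : L) : lift φ hφ (proj L I x) = φ x := rfl

end LCLieHom

/-! ### Short exact sequences -/

/-- The sequence `0 → A → B → C → 0` is a short exact sequence of locally convex Lie algebras:
`i` is a topological embedding onto the kernel of `r`, and `r` has a continuous linear section. -/
def IsShortExact {A B C : LCLieAlg.{u}} (i : LCLieHom A B) (r : LCLieHom B C) : Prop :=
  IsEmbedding i ∧ (∀ x, r x = 0 ↔ ∃ y, i y = x) ∧ ∃ q : C →L[ℝ] B, ∀ z, r (q z) = z

namespace IsShortExact

variable {A B C : LCLieAlg.{u}} {i : LCLieHom A B} {r : LCLieHom B C}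

theorem injective (h : IsShortExact i r) : Function.Injective i := h.1.injective

theorem r_i (h : IsShortExact i r) (y : A) : r (i y) = 0 := (h.2.1 _).2 ⟨y, rfl⟩

theorem exists_retraction (h : IsShortExact i r) (q : C →L[ℝ] B) (hq : ∀ z, r (q z) = z) :
    ∃ j : B →L[ℝ] A, ∀ x, i (j x) + q (r x) = x := by
  have h1 : ∀ x, ∃ y, i y = x - q (r x) := fun x => (h.2.1 _).1 (by simp [hq])
  choose j hj using h1
  refine ⟨⟨⟨⟨j, fun x y => h.injective ?_⟩, fun c x => h.injective ?_⟩, ?_⟩, fun x => ?_⟩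
  · simp only [map_add, hj]; abel
  · simp only [map_smul, hj, smul_sub, RingHom.id_apply]
  · rw [h.1.isInducing.continuous_iff]
    have : (i ∘ j) = fun x => x - q (r x) := funext hj
    change Continuous (i ∘ j)
    rw [this]
    fun_prop
  · exact (congrArg (· + q (r x)) (hj x)).trans (by simp)

/-- The continuous linear retraction `j` of `i` determined by a section `q` of `r` through
`i j + q r = id`. -/
noncomputable def retraction (h : IsShortExact i r) (q : C →L[ℝ] B) (hq : ∀ z, r (q z) = z) :
    B →L[ℝ] A :=
  (h.exists_retraction q hq).choose

theorem retraction_spec (h : IsShortExact i r) (q : C →L[ℝ] B) (hq : ∀ z, r (q z) = z) (x : B) :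
    i (h.retraction q hq x) + q (r x) = x :=
  (h.exists_retraction q hq).choose_spec x

theorem of_splitting (q : C →L[ℝ] B) (j : B →L[ℝ] A) (hq : ∀ z, r (q z) = z)
    (hj : ∀ y, j (i y) = y) (hqj : ∀ x, i (j x) + q (r x) = x) : IsShortExact i r := by
  refine ⟨Function.LeftInverse.isEmbedding (f := j) hj j.continuous i.continuous, fun x => ?_,
    q, hq⟩
  constructor
  · intro hx
    exact ⟨j x, by simpa [hx] using hqj x⟩
  · rintro ⟨y, rfl⟩
    have h := hqj (i y)
    rw [hj] at h
    have h2 : q (r (i y)) = 0 := by simpa using h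
    simpa [hq] using congrArg r h2

end IsShortExact

/-! ### Central crossed modules of Lie algebras -/

/-- A central, smoothly separable crossed module `𝔥 → 𝔤 → Der 𝔥` of locally convex Lie algebras. -/
structure CrMod : Type (u + 1) where
  h : LCLieAlg.{u}
  g : LCLieAlg.{u}
  t : LCLieHom h g
  α : g →ₗ⁅ℝ⁆ LieDerivation ℝ h h
  continuous_α : Continuous fun x : g × h => α x.1 x.2
  equivariant : ∀ (X : g) (y : h), t (α X y) = ⁅X, t y⁆
  peiffer : ∀ x y : h, α (t x) y = ⁅x, y⁆
  central : ∀ (X : g) (y : h), t y = 0 → α X y = 0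
  complemented_ker : (LinearMap.ker t.toCLM.toLinearMap).ClosedComplemented
  complemented_range : (LinearMap.range t.toCLM.toLinearMap).ClosedComplemented

namespace CrMod

/-- The quotient `𝔣 = 𝔤 / t(𝔥)`, as a topological vector space. -/
abbrev f (G : CrMod.{u}) : Type u := G.g ⧸ LinearMap.range G.t.toCLM.toLinearMap

/-- The projection `𝔤 → 𝔣`. -/
def p (G : CrMod.{u}) : G.g →L[ℝ] G.f := Submodule.mkQL _

variable (G : CrMod.{u})

@[simp] theorem p_t (y : G.h) : G.p (G.t y) = 0 :=
  (Submodule.Quotient.mk_eq_zero _).2 ⟨y, rfl⟩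

theorem p_surjective (a : G.f) : ∃ X, G.p X = a := Submodule.mkQ_surjective _ a

theorem p_eq_zero {X : G.g} (h : G.p X = 0) : ∃ y, G.t y = X :=
  (Submodule.Quotient.mk_eq_zero _).1 h

/-- The continuous linear map on `𝔣` induced by a continuous linear map on `𝔤` that vanishes
on `t(𝔥)`. -/
def fLift {E : Type u} [AddCommGroup E] [Module ℝ E] [TopologicalSpace E] (φ : G.g →L[ℝ] E)
    (hφ : ∀ y, φ (G.t y) = 0) : G.f →L[ℝ] E :=
  Submodule.liftQL _ φ (by rintro _ ⟨y, rfl⟩; exact hφ y)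

@[simp] theorem fLift_p {E : Type u} [AddCommGroup E] [Module ℝ E] [TopologicalSpace E]
    (φ : G.g →L[ℝ] E) (hφ : ∀ y, φ (G.t y) = 0) (X : G.g) : G.fLift φ hφ (G.p X) = φ X := rfl

end CrMod

/-! ### Butterflies -/

/-- A butterfly `G₁ → G₂` between crossed modules of Lie algebras: the wings commute, the NW-SE
sequence `𝔥₁ → 𝔨 → 𝔤₂` is a complex, the NE-SW sequence `𝔥₂ → 𝔨 → 𝔤₁` is short exact. -/
structure Butterfly (G₁ G₂ : CrMod.{u}) : Type (u + 1) where
  k : LCLieAlg.{u}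
  i₁ : LCLieHom G₁.h k
  i₂ : LCLieHom G₂.h k
  r₁ : LCLieHom k G₁.g
  r₂ : LCLieHom k G₂.g
  r₁_i₁ : ∀ y, r₁ (i₁ y) = G₁.t y
  r₂_i₂ : ∀ y, r₂ (i₂ y) = G₂.t y
  r₂_i₁ : ∀ y, r₂ (i₁ y) = 0
  exact : IsShortExact i₂ r₁
  i₁_α : ∀ x y, i₁ (G₁.α (r₁ x) y) = ⁅x, i₁ y⁆
  i₂_α : ∀ x y, i₂ (G₂.α (r₂ x) y) = ⁅x, i₂ y⁆

namespace Butterfly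

variable {G₁ G₂ G₃ G₄ : CrMod.{u}}

/-- A butterfly is invertible if its NW-SE sequence is short exact, too. -/
def IsInvertible (B : Butterfly G₁ G₂) : Prop := IsShortExact B.i₁ B.r₂

attribute [simp] r₁_i₁ r₂_i₂ r₂_i₁

@[simp] theorem r₁_i₂ (B : Butterfly G₁ G₂) (y : G₂.h) : B.r₁ (B.i₂ y) = 0 := B.exact.r_i y

/-! #### The identity butterfly -/

open LieAlgebra in
/-- The semi-direct sum `𝔥 ⋊ 𝔤` with the product topology, with the bracket
`⁅(y, X), (y', X')⁆ = (⁅y, y'⁆ + α X y' - α X' y, ⁅X, X'⁆)`. -/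
def semidirect (G : CrMod.{u}) : LCLieAlg.{u} :=
  letI T : TopologicalSpace (G.h ⋊⁅G.α⁆ G.g) :=
    TopologicalSpace.induced (SemiDirectSum.toProdl G.α) inferInstance
  { carrier := G.h ⋊⁅G.α⁆ G.g
    topology := T
    isTopologicalAddGroup := topologicalAddGroup_induced (SemiDirectSum.toProdl G.α)
    continuousSMul := continuousSMul_induced (SemiDirectSum.toProdl G.α)
    locallyConvex := LocallyConvexSpace.induced (SemiDirectSum.toProdl G.α).toLinearMap
    continuous_lie := by
      have hl : Continuous fun x : G.h ⋊⁅G.α⁆ G.g => x.left :=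
        continuous_fst.comp (continuous_induced_dom (f := SemiDirectSum.toProdl G.α))
      have hr : Continuous fun x : G.h ⋊⁅G.α⁆ G.g => x.right :=
        continuous_snd.comp (continuous_induced_dom (f := SemiDirectSum.toProdl G.α))
      refine continuous_induced_rng.2 (Continuous.prodMk ?_ ?_)
      · refine ((G.h.continuous_lie.comp ((hl.comp continuous_fst).prodMk
          (hl.comp continuous_snd))).add (G.continuous_α.comp ((hr.comp continuous_fst).prodMk
          (hl.comp continuous_snd)))).sub (G.continuous_α.comp ((hr.comp continuous_snd).prodMk
          (hl.comp continuous_fst)))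
      · exact G.g.continuous_lie.comp ((hr.comp continuous_fst).prodMk
          (hr.comp continuous_snd)) }

/-- The identification of the semi-direct sum with the product, as topological vector spaces. -/
def semidirectEquiv (G : CrMod.{u}) : (semidirect G) ≃L[ℝ] G.h × G.g where
  toLinearEquiv := LieAlgebra.SemiDirectSum.toProdl G.α
  continuous_toFun := continuous_induced_dom
  continuous_invFun := continuous_induced_rng.2 continuous_id

theorem semidirectEquiv_lie (G : CrMod.{u}) (x y : semidirect G) :
    semidirectEquiv G ⁅x, y⁆ =
      (⁅(semidirectEquiv G x).1, (semidirectEquiv G y).1⁆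
        + G.α (semidirectEquiv G x).2 (semidirectEquiv G y).1
        - G.α (semidirectEquiv G y).2 (semidirectEquiv G x).1,
       ⁅(semidirectEquiv G x).2, (semidirectEquiv G y).2⁆) := rfl

/-- The element `(y, X)` of the semi-direct sum. -/
def sd {G : CrMod.{u}} (y : G.h) (X : G.g) : semidirect G := (semidirectEquiv G).symm (y, X)

theorem sd_lie {G : CrMod.{u}} (y y' : G.h) (X X' : G.g) :
    ⁅sd y X, sd y' X'⁆ = sd (⁅y, y'⁆ + G.α X y' - G.α X' y) ⁅X, X'⁆ := rfl

theorem sd_add {G : CrMod.{u}} (y y' : G.h) (X X' : G.g) :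
    sd y X + sd y' X' = sd (y + y') (X + X') := rfl

theorem exists_sd {G : CrMod.{u}} (x : semidirect G) : ∃ y X, x = sd y X :=
  ⟨(semidirectEquiv G x).1, (semidirectEquiv G x).2, rfl⟩

/-- The canonical section `X ↦ (0, X)` of the identity butterfly. -/
def idSection (G : CrMod.{u}) : G.g →L[ℝ] semidirect G :=
  (semidirectEquiv G).symm.toContinuousLinearMap.comp (ContinuousLinearMap.inr ℝ G.h G.g)

theorem idSection_apply {G : CrMod.{u}} (X : G.g) : idSection G X = sd 0 X := rfl

/-- The identity butterfly: `i₁ y = (-y, t y)`, `i₂ y = (y, 0)`, `r₁ (y, X) = X`,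
`r₂ (y, X) = t y + X`. -/
def id (G : CrMod.{u}) : Butterfly G G where
  k := semidirect G
  i₁ := LCLieHom.ofCLM ((semidirectEquiv G).symm.toContinuousLinearMap.comp
      ((-ContinuousLinearMap.id ℝ G.h).prod G.t.toCLM)) fun x y => by
    change sd (-⁅x, y⁆) (G.t ⁅x, y⁆) = ⁅sd (-x) (G.t x), sd (-y) (G.t y)⁆
    rw [sd_lie, LCLieHom.map_lie]
    congr 1
    rw [map_neg, map_neg, G.peiffer, G.peiffer, ← lie_skew x y]
    simp
  i₂ := LCLieHom.ofCLM ((semidirectEquiv G).symm.toContinuousLinearMap.comp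
      (ContinuousLinearMap.inl ℝ G.h G.g)) fun x y => by
    change sd ⁅x, y⁆ 0 = ⁅sd x 0, sd y 0⁆
    rw [sd_lie]
    simp
  r₁ := LCLieHom.ofCLM ((ContinuousLinearMap.snd ℝ G.h G.g).comp
      (semidirectEquiv G).toContinuousLinearMap) fun x y => rfl
  r₂ := LCLieHom.ofCLM ((G.t.toCLM.coprod (ContinuousLinearMap.id ℝ G.g)).comp
      (semidirectEquiv G).toContinuousLinearMap) fun x x' => by
    obtain ⟨y, X, rfl⟩ := exists_sd x
    obtain ⟨y', X', rfl⟩ := exists_sd x'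
    rw [sd_lie]
    change G.t (⁅y, y'⁆ + G.α X y' - G.α X' y) + ⁅X, X'⁆ = ⁅G.t y + X, G.t y' + X'⁆
    simp only [map_add, map_sub, LCLieHom.map_lie, G.equivariant, add_lie, lie_add]
    rw [← lie_skew X' (G.t y)]
    abel
  r₁_i₁ y := rfl
  r₂_i₂ y := by
    change G.t y + 0 = G.t y
    simp
  r₂_i₁ y := by
    change G.t (-y) + G.t y = 0
    simp
  exact := IsShortExact.of_splitting (idSection G)
    ((ContinuousLinearMap.fst ℝ G.h G.g).comp (semidirectEquiv G).toContinuousLinearMap)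
    (fun _ => rfl) (fun _ => rfl) fun x => by
      obtain ⟨y, X, rfl⟩ := exists_sd x
      change sd y 0 + sd 0 X = sd y X
      simp [sd_add]
  i₁_α x y := by
    obtain ⟨z, X, rfl⟩ := exists_sd x
    change sd (-G.α X y) (G.t (G.α X y)) = ⁅sd z X, sd (-y) (G.t y)⁆
    rw [sd_lie, G.equivariant, G.peiffer, ← lie_skew y z]
    simp
  i₂_α x y := by
    obtain ⟨z, X, rfl⟩ := exists_sd x
    change sd (G.α (G.t z + X) y) 0 = ⁅sd z X, sd y 0⁆
    rw [sd_lie, map_add, LieDerivation.add_apply, G.peiffer]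
    simp

@[simp] theorem id_r₁_sd {G : CrMod.{u}} (y : G.h) (X : G.g) : (id G).r₁ (sd y X) = X := rfl
@[simp] theorem id_r₂_sd {G : CrMod.{u}} (y : G.h) (X : G.g) :
    (id G).r₂ (sd y X) = G.t y + X := rfl
@[simp] theorem id_i₁ {G : CrMod.{u}} (y : G.h) : (id G).i₁ y = sd (-y) (G.t y) := rfl
@[simp] theorem id_i₂ {G : CrMod.{u}} (y : G.h) : (id G).i₂ y = sd y 0 := rfl

theorem id_isInvertible (G : CrMod.{u}) : (id G).IsInvertible :=
  IsShortExact.of_splitting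
    ((semidirectEquiv G).symm.toContinuousLinearMap.comp (ContinuousLinearMap.inr ℝ G.h G.g))
    (-(ContinuousLinearMap.fst ℝ G.h G.g).comp (semidirectEquiv G).toContinuousLinearMap)
    (fun X => by change G.t 0 + X = X; simp) (fun y => by change - -y = y; simp) fun x => by
      obtain ⟨y, X, rfl⟩ := exists_sd x
      change sd (- -y) (G.t (-y)) + sd 0 (G.t y + X) = sd y X
      simp [sd_add]

/-! #### Composition of butterflies -/

section comp

variable (B : Butterfly G₁ G₂) (B' : Butterfly G₂ G₃)

/-- The fibre product `𝔨 ×_{𝔤₂} 𝔨'`, as a Lie subalgebra of the product. -/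
def fibreProdSub : LieSubalgebra ℝ (B.k.prod B'.k) where
  carrier := {x | B.r₂ (LCLieHom.fst _ _ x) = B'.r₁ (LCLieHom.snd _ _ x)}
  add_mem' {x y} hx hy := by
    simp only [Set.mem_ofPred_eq, map_add] at hx hy ⊢
    rw [hx, hy]
  zero_mem' := by simp
  smul_mem' c x hx := by
    simp only [Set.mem_ofPred_eq, map_smul] at hx ⊢
    rw [hx]
  lie_mem' {x y} hx hy := by
    simp only [Set.mem_ofPred_eq, LCLieHom.map_lie] at hx hy ⊢
    rw [hx, hy]

/-- The fibre product `𝔨 ×_{𝔤₂} 𝔨'`. -/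
def fibreProd : LCLieAlg.{u} := (B.k.prod B'.k).sub (fibreProdSub B B')

/-- The projection `𝔨 ×_{𝔤₂} 𝔨' → 𝔨`. -/
def pr₁ : LCLieHom (fibreProd B B') B.k :=
  (LCLieHom.fst B.k B'.k).comp (LCLieHom.subtype _ (fibreProdSub B B'))

/-- The projection `𝔨 ×_{𝔤₂} 𝔨' → 𝔨'`. -/
def pr₂ : LCLieHom (fibreProd B B') B'.k :=
  (LCLieHom.snd B.k B'.k).comp (LCLieHom.subtype _ (fibreProdSub B B'))

theorem r₂_pr₁ (x : fibreProd B B') : B.r₂ (pr₁ B B' x) = B'.r₁ (pr₂ B B' x) := x.2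

variable {B B'} in
theorem fibreProd_ext {x y : fibreProd B B'} (h₁ : pr₁ B B' x = pr₁ B B' y)
    (h₂ : pr₂ B B' x = pr₂ B B' y) : x = y := Subtype.ext (Prod.ext h₁ h₂)

/-- Continuous linear maps into the fibre product. -/
def pairL {E : Type u} [AddCommGroup E] [Module ℝ E] [TopologicalSpace E] (a : E →L[ℝ] B.k)
    (b : E →L[ℝ] B'.k) (h : ∀ x, B.r₂ (a x) = B'.r₁ (b x)) : E →L[ℝ] fibreProd B B' where
  toFun x := ⟨(a x, b x), h x⟩
  map_add' x y := fibreProd_ext (map_add a x y) (map_add b x y)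
  map_smul' c x := fibreProd_ext (map_smul a c x) (map_smul b c x)
  cont := Continuous.subtype_mk (by exact a.continuous.prodMk b.continuous) _

/-- The element `(a, b)` of the fibre product. -/
def pair (a : B.k) (b : B'.k) (h : B.r₂ a = B'.r₁ b) : fibreProd B B' := ⟨(a, b), h⟩

@[simp] theorem pr₁_pair (a : B.k) (b : B'.k) (h) : pr₁ B B' (pair B B' a b h) = a := rfl
@[simp] theorem pr₂_pair (a : B.k) (b : B'.k) (h) : pr₂ B B' (pair B B' a b h) = b := rfl

/-- The ideal `{(i₂ y, i₂' y) | y ∈ 𝔥₂}` of the fibre product. -/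
def diagIdeal : LieIdeal ℝ (fibreProd B B') where
  carrier := {x | ∃ y, pr₁ B B' x = B.i₂ y ∧ pr₂ B B' x = B'.i₁ y}
  add_mem' := by
    rintro x x' ⟨y, h₁, h₂⟩ ⟨y', h₁', h₂'⟩
    exact ⟨y + y', by simp [h₁, h₁'], by simp [h₂, h₂']⟩
  zero_mem' := ⟨0, by simp, by simp⟩
  smul_mem' := by
    rintro c x ⟨y, h₁, h₂⟩
    exact ⟨c • y, by simp [h₁], by simp [h₂]⟩
  lie_mem := by
    rintro x x' ⟨y, h₁, h₂⟩
    refine ⟨G₂.α (B.r₂ (pr₁ B B' x)) y, ?_, ?_⟩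
    · rw [B.i₂_α, ← h₁]; exact (pr₁ B B').map_lie x x'
    · rw [r₂_pr₁, B'.i₁_α, ← h₂]; exact (pr₂ B B').map_lie x x'

/-- The Lie algebra `(𝔨 ×_{𝔤₂} 𝔨') / 𝔥₂`. -/
def compAlg : LCLieAlg.{u} := (fibreProd B B').quot (diagIdeal B B')

/-- The class `[a, b]` of an element of the fibre product. -/
def cls : LCLieHom (fibreProd B B') (compAlg B B') := LCLieHom.proj _ _

variable {B B'} in
theorem exists_cls (x : compAlg B B') : ∃ a b h, x = cls B B' (pair B B' a b h) := by
  obtain ⟨y, rfl⟩ := LCLieHom.proj_surjective x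
  exact ⟨pr₁ B B' y, pr₂ B B' y, r₂_pr₁ B B' y, rfl⟩

variable {B B'} in
theorem cls_eq {x x' : fibreProd B B'} (y : G₂.h) (h₁ : pr₁ B B' x = pr₁ B B' x' + B.i₂ y)
    (h₂ : pr₂ B B' x = pr₂ B B' x' + B'.i₁ y) : cls B B' x = cls B B' x' := by
  rw [← sub_eq_zero, ← map_sub]
  exact LCLieHom.proj_eq_zero.2 ⟨y, by simp [h₁], by simp [h₂]⟩

/-- Continuous linear maps out of the composition. -/
def descL {M : LCLieAlg.{u}} (φ : fibreProd B B' →L[ℝ] M)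
    (hφ : ∀ x y, pr₁ B B' x = B.i₂ y → pr₂ B B' x = B'.i₁ y → φ x = 0) :
    compAlg B B' →L[ℝ] M :=
  LCLieHom.liftL φ (by rintro x ⟨y, h₁, h₂⟩; exact hφ x y h₁ h₂)

/-- Homomorphisms out of the composition. -/
def desc {M : LCLieAlg.{u}} (φ : LCLieHom (fibreProd B B') M)
    (hφ : ∀ x y, pr₁ B B' x = B.i₂ y → pr₂ B B' x = B'.i₁ y → φ x = 0) :
    LCLieHom (compAlg B B') M :=
  LCLieHom.lift φ (by rintro x ⟨y, h₁, h₂⟩; exact hφ x y h₁ h₂)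

@[simp] theorem descL_cls {M : LCLieAlg.{u}} (φ : fibreProd B B' →L[ℝ] M) (hφ) (x) :
    descL B B' φ hφ (cls B B' x) = φ x := rfl

@[simp] theorem desc_cls {M : LCLieAlg.{u}} (φ : LCLieHom (fibreProd B B') M) (hφ) (x) :
    desc B B' φ hφ (cls B B' x) = φ x := rfl

/-- The map `ĩ₁ y = [i₁ y, 0]`. -/
def compI₁ : LCLieHom G₁.h (compAlg B B') :=
  (cls B B').comp (LCLieHom.ofCLM (pairL B B' B.i₁.toCLM 0 (by simp)) fun x y =>
    fibreProd_ext (B.i₁.map_lie x y) (by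
      rw [LCLieHom.map_lie]; change (0 : B'.k) = ⁅(0 : B'.k), (0 : B'.k)⁆; simp))

/-- The map `ĩ₃ y = [0, i₃' y]`. -/
def compI₂ : LCLieHom G₃.h (compAlg B B') :=
  (cls B B').comp (LCLieHom.ofCLM (pairL B B' 0 B'.i₂.toCLM (by simp)) fun x y =>
    fibreProd_ext (by
      rw [LCLieHom.map_lie]; change (0 : B.k) = ⁅(0 : B.k), (0 : B.k)⁆; simp)
      (B'.i₂.map_lie x y))

/-- The map `r̃₁ [a, b] = r₁ a`. -/
def compR₁ : LCLieHom (compAlg B B') G₁.g :=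
  desc B B' (B.r₁.comp (pr₁ B B')) fun x y h₁ _ => by simp [h₁]

/-- The map `r̃₃ [a, b] = r₃' b`. -/
def compR₂ : LCLieHom (compAlg B B') G₃.g :=
  desc B B' (B'.r₂.comp (pr₂ B B')) fun x y _ h₂ => by simp [h₂]

theorem compI₁_apply (y : G₁.h) :
    compI₁ B B' y = cls B B' (pair B B' (B.i₁ y) 0 (by simp)) := rfl

theorem compI₂_apply (y : G₃.h) :
    compI₂ B B' y = cls B B' (pair B B' 0 (B'.i₂ y) (by simp)) := rfl

@[simp] theorem compR₁_cls (x : fibreProd B B') :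
    compR₁ B B' (cls B B' x) = B.r₁ (pr₁ B B' x) := rfl

@[simp] theorem compR₂_cls (x : fibreProd B B') :
    compR₂ B B' (cls B B' x) = B'.r₂ (pr₂ B B' x) := rfl

variable {B B'} in
/-- The section `X ↦ [q X, q' (r₂ (q X))]` of the composition. -/
def compSection (q : G₁.g →L[ℝ] B.k) (q' : G₂.g →L[ℝ] B'.k) (hq' : ∀ X, B'.r₁ (q' X) = X) :
    G₁.g →L[ℝ] compAlg B B' :=
  (cls B B').toCLM.comp
    (pairL B B' q (q'.comp (B.r₂.toCLM.comp q)) fun X => by simp [hq'])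

theorem compSection_apply (q : G₁.g →L[ℝ] B.k) (q' : G₂.g →L[ℝ] B'.k)
    (hq' : ∀ X, B'.r₁ (q' X) = X) (X : G₁.g) : compSection q q' hq' X =
      cls B B' (pair B B' (q X) (q' (B.r₂ (q X))) (by simp [hq'])) := rfl

/-- The map `[a, b] ↦ j' (b - i₂' (j a))`. -/
def compRetraction (j : B.k →L[ℝ] G₂.h) (j' : B'.k →L[ℝ] G₃.h) (hj : ∀ y, j (B.i₂ y) = y) :
    compAlg B B' →L[ℝ] G₃.h :=
  descL B B' (j'.comp ((pr₂ B B').toCLM - B'.i₁.toCLM.comp (j.comp (pr₁ B B').toCLM)))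
    fun x y h₁ h₂ => by simp [h₁, h₂, hj]

theorem compRetraction_cls (j : B.k →L[ℝ] G₂.h) (j' : B'.k →L[ℝ] G₃.h) (hj : ∀ y, j (B.i₂ y) = y)
    (x : fibreProd B B') : compRetraction B B' j j' hj (cls B B' x) =
      j' (pr₂ B B' x - B'.i₁ (j (pr₁ B B' x))) := rfl

end comp

section comp

variable (B : Butterfly G₁ G₂) (B' : Butterfly G₂ G₃)

theorem compRetraction_spec (q : G₁.g →L[ℝ] B.k) {q' : G₂.g →L[ℝ] B'.k}
    (hq' : ∀ X, B'.r₁ (q' X) = X) {j : B.k →L[ℝ] G₂.h} {j' : B'.k →L[ℝ] G₃.h}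
    (hj : ∀ x, B.i₂ (j x) + q (B.r₁ x) = x) (hj' : ∀ x, B'.i₂ (j' x) + q' (B'.r₁ x) = x)
    (hji : ∀ y, j (B.i₂ y) = y) (x : compAlg B B') :
    compI₂ B B' (compRetraction B B' j j' hji x) + compSection q q' hq' (compR₁ B B' x) = x := by
  obtain ⟨a, b, h, rfl⟩ := exists_cls x
  rw [compRetraction_cls, compI₂_apply, compR₁_cls, compSection_apply, ← map_add]
  refine cls_eq (-j a) ?_ ?_
  · simp only [map_add, pr₁_pair, map_neg]
    rw [← sub_eq_add_neg, zero_add, eq_sub_iff_add_eq, add_comm, hj]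
  · have h1 := hj' (b - B'.i₁ (j a))
    have h2 : B.r₂ (q (B.r₁ a)) = B'.r₁ (b - B'.i₁ (j a)) := by
      rw [map_sub, ← h, B'.r₁_i₁, ← B.r₂_i₂, ← map_sub]
      exact congrArg _ (eq_sub_of_add_eq' (hj a))
    simp only [map_add, pr₁_pair, pr₂_pair, map_neg, h2, h1]
    abel

/-- The composition `𝔨' ∘ 𝔨 : G₁ → G₃` of butterflies `𝔨 : G₁ → G₂` and `𝔨' : G₂ → G₃`. -/
def comp : Butterfly G₁ G₃ where
  k := compAlg B B'
  i₁ := compI₁ B B'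
  i₂ := compI₂ B B'
  r₁ := compR₁ B B'
  r₂ := compR₂ B B'
  r₁_i₁ y := B.r₁_i₁ y
  r₂_i₂ y := B'.r₂_i₂ y
  r₂_i₁ y := map_zero B'.r₂
  exact := by
    obtain ⟨q, hq⟩ := B.exact.2.2
    obtain ⟨q', hq'⟩ := B'.exact.2.2
    have hj := B.exact.retraction_spec q hq
    have hj' := B'.exact.retraction_spec q' hq'
    set j := B.exact.retraction q hq
    set j' := B'.exact.retraction q' hq'
    have hji : ∀ y, j (B.i₂ y) = y := fun y => B.exact.injective (by simpa using hj (B.i₂ y))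
    have hji' : ∀ y, j' (B'.i₂ y) = y := fun y => B'.exact.injective (by simpa using hj' (B'.i₂ y))
    exact IsShortExact.of_splitting (compSection q q' hq') (compRetraction B B' j j' hji)
      (fun X => by simp [compSection_apply, hq]) (fun y => by
        simp [compI₂_apply, compRetraction_cls, hji'])
      (compRetraction_spec B B' q hq' hj hj' hji)
  i₁_α x y := by
    obtain ⟨a, b, h, rfl⟩ := exists_cls x
    rw [compR₁_cls, compI₁_apply, compI₁_apply, ← LCLieHom.map_lie]
    congr 1
    refine fibreProd_ext ?_ ?_
    · rw [LCLieHom.map_lie]; exact B.i₁_α a y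
    · rw [LCLieHom.map_lie]; simp
  i₂_α x y := by
    obtain ⟨a, b, h, rfl⟩ := exists_cls x
    rw [compR₂_cls, compI₂_apply, compI₂_apply, ← LCLieHom.map_lie]
    congr 1
    refine fibreProd_ext ?_ ?_
    · rw [LCLieHom.map_lie]; simp
    · rw [LCLieHom.map_lie]; exact B'.i₂_α b y

variable {B B'} in
theorem comp_isInvertible (hB : B.IsInvertible) (hB' : B'.IsInvertible) :
    (B.comp B').IsInvertible := by
  obtain ⟨q, hq⟩ := hB.2.2
  obtain ⟨q', hq'⟩ := hB'.2.2
  have hj := hB.retraction_spec q hq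
  have hj' := hB'.retraction_spec q' hq'
  set j := hB.retraction q hq
  set j' := hB'.retraction q' hq'
  have hji : ∀ y, j (B.i₁ y) = y := fun y => hB.injective (by simpa using hj (B.i₁ y))
  have hji' : ∀ y, j' (B'.i₁ y) = y := fun y => hB'.injective (by simpa using hj' (B'.i₁ y))
  refine IsShortExact.of_splitting
    ((cls B B').toCLM.comp (pairL B B' (q.comp (B'.r₁.toCLM.comp q')) q' fun X => by simp [hq]))
    (descL B B' (j.comp ((pr₁ B B').toCLM - B.i₂.toCLM.comp (j'.comp (pr₂ B B').toCLM)))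
      fun x y h₁ h₂ => by simp [h₁, h₂, hji']) (fun Z => hq' Z) (fun y => ?_) fun x => ?_
  · change j (B.i₁ y - B.i₂ (j' 0)) = y
    simp [hji]
  · obtain ⟨a, b, h, rfl⟩ := exists_cls x
    change cls B B' (pair B B' (B.i₁ (j (a - B.i₂ (j' b)))) 0 _) +
      cls B B' (pair B B' (q (B'.r₁ (q' (B'.r₂ b)))) (q' (B'.r₂ b)) _) = _
    rw [← map_add]
    refine cls_eq (-j' b) ?_ ?_
    · have h1 := hj (a - B.i₂ (j' b))
      have h2 : B'.r₁ (q' (B'.r₂ b)) = B.r₂ (a - B.i₂ (j' b)) := by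
        rw [map_sub, h, B.r₂_i₂, ← B'.r₁_i₁, ← map_sub]
        exact congrArg _ (eq_sub_of_add_eq' (hj' b))
      change B.i₁ (j (a - B.i₂ (j' b))) + q (B'.r₁ (q' (B'.r₂ b))) = a + B.i₂ (-j' b)
      rw [h2, h1, map_neg, sub_eq_add_neg]
    · change (0 : B'.k) + q' (B'.r₂ b) = b + B'.i₁ (-j' b)
      rw [map_neg, ← sub_eq_add_neg, zero_add, eq_sub_iff_add_eq, add_comm, hj']

end comp

/-! #### Morphisms of butterflies -/

/-- A morphism of butterflies is a homomorphism `𝔨 → 𝔨'` that commutes with all other maps. -/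
structure Hom (B B' : Butterfly G₁ G₂) : Type u where
  map : LCLieHom B.k B'.k
  map_i₁ : ∀ y, map (B.i₁ y) = B'.i₁ y
  map_i₂ : ∀ y, map (B.i₂ y) = B'.i₂ y
  r₁_map : ∀ x, B'.r₁ (map x) = B.r₁ x
  r₂_map : ∀ x, B'.r₂ (map x) = B.r₂ x

attribute [simp] Hom.map_i₁ Hom.map_i₂ Hom.r₁_map Hom.r₂_map

theorem Hom.ext' {B B' : Butterfly G₁ G₂} {σ τ : Hom B B'} (h : ∀ x, σ.map x = τ.map x) :
    σ = τ := by
  cases σ; cases τ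
  simpa using LCLieHom.ext h

/-- The left whiskering `[a, b] ↦ [a, σ b]`. -/
def whiskerLeft (B : Butterfly G₁ G₂) {B' B'' : Butterfly G₂ G₃} (σ : Hom B' B'') :
    Hom (B.comp B') (B.comp B'') where
  map := desc B B' ((cls B B'').comp (LCLieHom.ofCLM (pairL B B'' (pr₁ B B').toCLM
      (σ.map.toCLM.comp (pr₂ B B').toCLM) fun x => by simp [r₂_pr₁])
      fun x y => fibreProd_ext ((pr₁ B B').map_lie x y) (by
        rw [LCLieHom.map_lie]
        exact (congrArg _ ((pr₂ B B').map_lie x y)).trans (σ.map.map_lie _ _))))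
    fun x y h₁ h₂ => by
      refine (cls_eq (x' := 0) y ?_ ?_).trans (map_zero _)
      · rw [map_zero, zero_add]; exact h₁
      · rw [map_zero, zero_add, ← σ.map_i₁, ← h₂]; rfl
  map_i₁ y := congrArg (cls B B'') (fibreProd_ext rfl (map_zero σ.map))
  map_i₂ y := congrArg (cls B B'') (fibreProd_ext rfl (σ.map_i₂ y))
  r₁_map x := by obtain ⟨a, b, h, rfl⟩ := exists_cls x; rfl
  r₂_map x := by obtain ⟨a, b, h, rfl⟩ := exists_cls x; exact σ.r₂_map b

/-- The right whiskering `[a, b] ↦ [σ a, b]`. -/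
def whiskerRight {B B' : Butterfly G₁ G₂} (σ : Hom B B') (B'' : Butterfly G₂ G₃) :
    Hom (B.comp B'') (B'.comp B'') where
  map := desc B B'' ((cls B' B'').comp (LCLieHom.ofCLM (pairL B' B''
      (σ.map.toCLM.comp (pr₁ B B'').toCLM) (pr₂ B B'').toCLM fun x => by simp [r₂_pr₁])
      fun x y => fibreProd_ext (by
        rw [LCLieHom.map_lie]
        exact (congrArg _ ((pr₁ B B'').map_lie x y)).trans (σ.map.map_lie _ _))
        ((pr₂ B B'').map_lie x y)))
    fun x y h₁ h₂ => by
      refine (cls_eq (x' := 0) y ?_ ?_).trans (map_zero _)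
      · rw [map_zero, zero_add, ← σ.map_i₂, ← h₁]; rfl
      · rw [map_zero, zero_add]; exact h₂
  map_i₁ y := congrArg (cls B' B'') (fibreProd_ext (σ.map_i₁ y) rfl)
  map_i₂ y := congrArg (cls B' B'') (fibreProd_ext (map_zero σ.map) rfl)
  r₁_map x := by obtain ⟨a, b, h, rfl⟩ := exists_cls x; exact σ.r₁_map a
  r₂_map x := by obtain ⟨a, b, h, rfl⟩ := exists_cls x; rfl

theorem whiskerLeft_cls (B : Butterfly G₁ G₂) {B' B'' : Butterfly G₂ G₃} (σ : Hom B' B'')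
    (a : B.k) (b : B'.k) (h : B.r₂ a = B'.r₁ b) :
    (whiskerLeft B σ).map (cls B B' (pair B B' a b h)) =
      cls B B'' (pair B B'' a (σ.map b) (by simpa using h)) := rfl

theorem whiskerRight_cls {B B' : Butterfly G₁ G₂} (σ : Hom B B') (B'' : Butterfly G₂ G₃)
    (a : B.k) (b : B''.k) (h : B.r₂ a = B''.r₁ b) :
    (whiskerRight σ B'').map (cls B B'' (pair B B'' a b h)) =
      cls B' B'' (pair B' B'' (σ.map a) b (by simpa using h)) := rfl

end Butterfly

/-! ### The bicategory of crossed modules and invertible butterflies with sections -/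

/-- An invertible butterfly with a section `q` of its NE-SW sequence. -/
structure SecButterfly (G₁ G₂ : CrMod.{u}) : Type (u + 1) where
  B : Butterfly G₁ G₂
  invertible : B.IsInvertible
  q : G₁.g →L[ℝ] B.k
  r₁_q : ∀ X, B.r₁ (q X) = X

namespace SecButterfly

variable {G₁ G₂ G₃ G₄ : CrMod.{u}}

attribute [simp] r₁_q

/-- The retraction `j : 𝔨 → 𝔥₂`, determined by `i₂ j + q r₁ = id`. -/
noncomputable def j (S : SecButterfly G₁ G₂) : S.B.k →L[ℝ] G₂.h := S.B.exact.retraction S.q S.r₁_q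

/-- The continuous linear map `φ = r₂ q : 𝔤₁ → 𝔤₂`. -/
def φ (S : SecButterfly G₁ G₂) : G₁.g →L[ℝ] G₂.g := S.B.r₂.toCLM.comp S.q

/-- The continuous linear map `f = -j i₁ : 𝔥₁ → 𝔥₂`. -/
noncomputable def f (S : SecButterfly G₁ G₂) : G₁.h →L[ℝ] G₂.h := -S.j.comp S.B.i₁.toCLM

/-- The bilinear map `λ (X, Y) = j [q X, q Y]`. -/
noncomputable def lam (S : SecButterfly G₁ G₂) : G₁.g →ₗ[ℝ] G₁.g →ₗ[ℝ] G₂.h :=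
  LinearMap.mk₂ ℝ (fun X Y => S.j ⁅S.q X, S.q Y⁆) (by simp) (by simp) (by simp) (by simp)

section facts

variable (S : SecButterfly G₁ G₂)

theorem φ_apply (X : G₁.g) : S.φ X = S.B.r₂ (S.q X) := rfl
theorem f_apply (y : G₁.h) : S.f y = -S.j (S.B.i₁ y) := rfl
theorem lam_apply (X Y : G₁.g) : S.lam X Y = S.j ⁅S.q X, S.q Y⁆ := rfl

theorem i₂_j (x : S.B.k) : S.B.i₂ (S.j x) + S.q (S.B.r₁ x) = x :=
  S.B.exact.retraction_spec S.q S.r₁_q x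

theorem j_unique (J : S.B.k →L[ℝ] G₂.h) (hJ : ∀ x, S.B.i₂ (J x) + S.q (S.B.r₁ x) = x)
    (x : S.B.k) : S.j x = J x :=
  S.B.exact.injective (add_right_cancel ((S.i₂_j x).trans (hJ x).symm))

@[simp] theorem j_i₂ (y : G₂.h) : S.j (S.B.i₂ y) = y :=
  S.B.exact.injective (by simpa using S.i₂_j (S.B.i₂ y))

@[simp] theorem j_q (X : G₁.g) : S.j (S.q X) = 0 :=
  S.B.exact.injective (by simpa using S.i₂_j (S.q X))

theorem k_ext {x y : S.B.k} (h₁ : S.B.r₁ x = S.B.r₁ y) (h₂ : S.j x = S.j y) : x = y := by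
  rw [← S.i₂_j x, ← S.i₂_j y, h₁, h₂]

theorem t_f (y : G₁.h) : G₂.t (S.f y) = S.φ (G₁.t y) := by
  have h := congrArg S.B.r₂ (S.i₂_j (S.B.i₁ y))
  simp only [map_add, Butterfly.r₂_i₂, Butterfly.r₁_i₁, Butterfly.r₂_i₁] at h
  rw [f_apply, map_neg, φ_apply]
  exact (eq_neg_of_add_eq_zero_right h).symm

theorem r₂_eq (x : S.B.k) : S.B.r₂ x = S.φ (S.B.r₁ x) + G₂.t (S.j x) := by
  have h := congrArg S.B.r₂ (S.i₂_j x)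
  simp only [map_add, Butterfly.r₂_i₂] at h
  rw [← h, φ_apply, add_comm]

theorem j_lie (x y : S.B.k) : S.j ⁅x, y⁆ = S.lam (S.B.r₁ x) (S.B.r₁ y)
    + G₂.α (S.φ (S.B.r₁ x)) (S.j y) - G₂.α (S.φ (S.B.r₁ y)) (S.j x) + ⁅S.j x, S.j y⁆ := by
  conv_lhs => rw [← S.i₂_j x, ← S.i₂_j y]
  rw [add_lie, lie_add, lie_add, ← S.B.i₂_α (S.q _), ← lie_skew _ (S.q _), ← S.B.i₂_α (S.q _),
    ← LCLieHom.map_lie]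
  simp only [map_add, map_neg, j_i₂, lam_apply, φ_apply]
  abel

/-- The exchange rule for `α`, `φ` and `f`. -/
theorem α_f (X : G₁.g) (y : G₁.h) :
    G₂.α (S.φ X) (S.f y) = S.f (G₁.α X y) + S.lam X (G₁.t y) := by
  have h := S.j_lie (S.q X) (S.B.i₁ y)
  rw [← S.B.i₁_α] at h
  simp only [r₁_q, Butterfly.r₁_i₁, j_q, map_zero, zero_lie, sub_zero, add_zero] at h
  rw [f_apply, f_apply, map_neg, h]
  abel

theorem lam_skew (X Y : G₁.g) : S.lam X Y = -S.lam Y X := by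
  rw [lam_apply, lam_apply, ← map_neg, lie_skew]

end facts

/-! #### Composition and identities -/

/-- The composition, equipped with the section `X ↦ [q X, q' (r₂ (q X))]`. -/
def comp (S : SecButterfly G₁ G₂) (S' : SecButterfly G₂ G₃) : SecButterfly G₁ G₃ where
  B := S.B.comp S'.B
  invertible := Butterfly.comp_isInvertible S.invertible S'.invertible
  q := Butterfly.compSection S.q S'.q S'.r₁_q
  r₁_q := S.r₁_q

/-- The identity butterfly, equipped with the section `X ↦ (0, X)`. -/
def id (G : CrMod.{u}) : SecButterfly G G where
  B := Butterfly.id G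
  invertible := Butterfly.id_isInvertible G
  q := Butterfly.idSection G
  r₁_q _ := rfl

theorem id_j (G : CrMod.{u}) (y : G.h) (X : G.g) : (id G).j (Butterfly.sd y X) = y :=
  (id G).j_unique ((ContinuousLinearMap.fst ℝ G.h G.g).comp
    (Butterfly.semidirectEquiv G).toContinuousLinearMap) (fun x => by
      obtain ⟨y, X, rfl⟩ := Butterfly.exists_sd x
      change Butterfly.sd y 0 + Butterfly.sd 0 X = Butterfly.sd y X
      simp [Butterfly.sd_add]) _

@[simp] theorem id_φ {G : CrMod.{u}} (X : G.g) : (id G).φ X = X := by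
  change G.t 0 + X = X
  simp

@[simp] theorem id_f {G : CrMod.{u}} (y : G.h) : (id G).f y = y :=
  (congrArg Neg.neg (id_j G (-y) (G.t y))).trans (neg_neg y)

@[simp] theorem id_lam {G : CrMod.{u}} (X Y : G.g) : (id G).lam X Y = 0 := by
  have h : (id G).lam X Y = (id G).j (Butterfly.sd (⁅(0 : G.h), (0 : G.h)⁆ + G.α X 0 - G.α Y 0)
    ⁅X, Y⁆) := rfl
  rw [h, id_j]
  simp

section

variable (S : SecButterfly G₁ G₂) (S' : SecButterfly G₂ G₃)

theorem comp_j (x : Butterfly.fibreProd S.B S'.B) :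
    (S.comp S').j (Butterfly.cls S.B S'.B x) =
      S'.j (Butterfly.pr₂ S.B S'.B x - S'.B.i₁ (S.j (Butterfly.pr₁ S.B S'.B x))) :=
  (S.comp S').j_unique (Butterfly.compRetraction S.B S'.B S.j S'.j S.j_i₂)
    (Butterfly.compRetraction_spec S.B S'.B S.q S'.r₁_q S.i₂_j S'.i₂_j S.j_i₂) _

@[simp] theorem comp_φ (X : G₁.g) : (S.comp S').φ X = S'.φ (S.φ X) := rfl

@[simp] theorem comp_f (y : G₁.h) : (S.comp S').f y = S'.f (S.f y) := by
  refine (congrArg Neg.neg (S.comp_j S'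
    (Butterfly.pair S.B S'.B (S.B.i₁ y) 0 (by simp)))).trans ?_
  simp [f_apply]

@[simp] theorem comp_lam (X Y : G₁.g) :
    (S.comp S').lam X Y = S'.f (S.lam X Y) + S'.lam (S.φ X) (S.φ Y) := by
  have h : ⁅(S.comp S').q X, (S.comp S').q Y⁆ = Butterfly.cls S.B S'.B
      ⁅Butterfly.pair S.B S'.B (S.q X) (S'.q (S.φ X)) (S'.r₁_q _).symm,
        Butterfly.pair S.B S'.B (S.q Y) (S'.q (S.φ Y)) (S'.r₁_q _).symm⁆ :=
    ((Butterfly.cls S.B S'.B).map_lie _ _).symm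
  rw [lam_apply, h, comp_j, LCLieHom.map_lie, LCLieHom.map_lie, map_sub, f_apply, lam_apply,
    lam_apply, sub_eq_neg_add]
  rfl

end

/-! #### The 2-morphisms -/

/-- The 2-morphisms are all morphisms between the underlying butterflies. -/
instance category : Category (SecButterfly G₁ G₂) where
  Hom S S' := Butterfly.Hom S.B S'.B
  id S := ⟨LCLieHom.id _, fun _ => rfl, fun _ => rfl, fun _ => rfl, fun _ => rfl⟩
  comp σ τ := ⟨τ.map.comp σ.map, fun y => by simp, fun y => by simp, fun x => by simp,
    fun x => by simp⟩

/-- The homomorphism `𝔨 → 𝔨'` underlying a 2-morphism. -/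
def homMap {S S' : SecButterfly G₁ G₂} (σ : S ⟶ S') : LCLieHom S.B.k S'.B.k :=
  Butterfly.Hom.map σ

/-- The continuous linear map `γ : 𝔤₁ → 𝔥₂` with `q' - σ q = i₂' γ`. -/
noncomputable def γ {S S' : SecButterfly G₁ G₂} (σ : S ⟶ S') : G₁.g →L[ℝ] G₂.h :=
  S'.j.comp (S'.q - (homMap σ).toCLM.comp S.q)

section hom

variable {S S' S'' : SecButterfly G₁ G₂} (σ : S ⟶ S') (τ : S' ⟶ S'')

@[simp] theorem r₁_homMap (x : S.B.k) : S'.B.r₁ (homMap σ x) = S.B.r₁ x :=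
  Butterfly.Hom.r₁_map σ x
@[simp] theorem r₂_homMap (x : S.B.k) : S'.B.r₂ (homMap σ x) = S.B.r₂ x :=
  Butterfly.Hom.r₂_map σ x
@[simp] theorem homMap_i₁ (y : G₁.h) : homMap σ (S.B.i₁ y) = S'.B.i₁ y :=
  Butterfly.Hom.map_i₁ σ y
@[simp] theorem homMap_i₂ (y : G₂.h) : homMap σ (S.B.i₂ y) = S'.B.i₂ y :=
  Butterfly.Hom.map_i₂ σ y

theorem γ_apply (X : G₁.g) : γ σ X = S'.j (S'.q X - homMap σ (S.q X)) := rfl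

theorem i₂_γ (X : G₁.g) : S'.B.i₂ (γ σ X) = S'.q X - homMap σ (S.q X) := by
  have h := S'.i₂_j (S'.q X - homMap σ (S.q X))
  rw [map_sub S'.B.r₁, r₁_homMap, r₁_q, r₁_q, sub_self, map_zero, add_zero] at h
  exact h

theorem homMap_q (X : G₁.g) : homMap σ (S.q X) = S'.q X - S'.B.i₂ (γ σ X) := by
  rw [i₂_γ]; abel

theorem j_homMap (x : S.B.k) : S'.j (homMap σ x) = S.j x - γ σ (S.B.r₁ x) := by
  conv_lhs => rw [← S.i₂_j x]
  rw [map_add, homMap_q, homMap_i₂]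
  simp [sub_eq_add_neg]

theorem φ_γ (X : G₁.g) : S'.φ X = S.φ X + G₂.t (γ σ X) := by
  have h := congrArg S'.B.r₂ (i₂_γ σ X)
  rw [Butterfly.r₂_i₂, map_sub, r₂_homMap] at h
  rw [h, φ_apply, φ_apply]; abel

theorem f_γ (y : G₁.h) : S'.f y = S.f y + γ σ (G₁.t y) := by
  have h := j_homMap σ (S.B.i₁ y)
  rw [homMap_i₁, Butterfly.r₁_i₁] at h
  rw [f_apply, f_apply, h]; abel

variable {σ} in
theorem hom_ext {σ' : S ⟶ S'} (h : ∀ X, γ σ X = γ σ' X) : σ = σ' := by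
  refine Butterfly.Hom.ext' fun x => ?_
  change homMap σ x = homMap σ' x
  rw [← S.i₂_j x, map_add, map_add, homMap_i₂, homMap_i₂, homMap_q, homMap_q, h]

@[simp] theorem γ_id (X : G₁.g) : γ (𝟙 S) X = 0 := by
  rw [γ_apply]
  change S.j (S.q X - S.q X) = 0
  simp

@[simp] theorem γ_comp (X : G₁.g) : γ (σ ≫ τ) X = γ σ X + γ τ X := by
  rw [γ_apply]
  change S''.j (S''.q X - homMap τ (homMap σ (S.q X))) = _
  rw [homMap_q, map_sub (homMap τ), homMap_i₂, homMap_q]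
  simp only [map_sub, j_q, j_i₂]
  abel

end hom

/-- If two butterflies with sections have the same associated maps `φ`, `f` and `λ`, then
`x ↦ q' (r₁ x) + i₂' (j x)` is an isomorphism of butterflies. -/
noncomputable def homOfEq (S S' : SecButterfly G₁ G₂) (hφ : ∀ X, S.φ X = S'.φ X)
    (hf : ∀ y, S.f y = S'.f y) (hl : ∀ X Y, S.lam X Y = S'.lam X Y) : S ⟶ S' :=
  Butterfly.Hom.mk
    (LCLieHom.ofCLM (S'.q.comp S.B.r₁.toCLM + S'.B.i₂.toCLM.comp S.j) fun x y => by
      refine S'.k_ext ?_ ?_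
      · simp [LCLieHom.map_lie]
      · rw [j_lie]
        simp [j_lie, LCLieHom.map_lie, hφ, hl])
    (fun y => S'.k_ext (by simp) (by
      have h := hf y
      simp only [f_apply, neg_inj] at h
      simp [h]))
    (fun y => by simp) (fun x => by simp)
    (fun x => by simp [r₂_eq, hφ])

@[simp] theorem γ_homOfEq (S S' : SecButterfly G₁ G₂) (hφ : ∀ X, S.φ X = S'.φ X)
    (hf : ∀ y, S.f y = S'.f y) (hl : ∀ X Y, S.lam X Y = S'.lam X Y) (X : G₁.g) :
    γ (homOfEq S S' hφ hf hl) X = 0 := by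
  rw [γ_apply]
  change S'.j (S'.q X - (S'.q (S.B.r₁ (S.q X)) + S'.B.i₂ (S.j (S.q X)))) = 0
  simp

/-- The isomorphism `homOfEq`. -/
noncomputable def isoOfEq (S S' : SecButterfly G₁ G₂) (hφ : ∀ X, S.φ X = S'.φ X)
    (hf : ∀ y, S.f y = S'.f y) (hl : ∀ X Y, S.lam X Y = S'.lam X Y) : S ≅ S' where
  hom := homOfEq S S' hφ hf hl
  inv := homOfEq S' S (fun X => (hφ X).symm) (fun y => (hf y).symm) (fun X Y => (hl X Y).symm)
  hom_inv_id := hom_ext fun X => by simp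
  inv_hom_id := hom_ext fun X => by simp

@[simp] theorem γ_isoOfEq_hom (S S' : SecButterfly G₁ G₂) (hφ : ∀ X, S.φ X = S'.φ X)
    (hf : ∀ y, S.f y = S'.f y) (hl : ∀ X Y, S.lam X Y = S'.lam X Y) (X : G₁.g) :
    γ (isoOfEq S S' hφ hf hl).hom X = 0 := γ_homOfEq S S' hφ hf hl X

@[simp] theorem γ_isoOfEq_inv (S S' : SecButterfly G₁ G₂) (hφ : ∀ X, S.φ X = S'.φ X)
    (hf : ∀ y, S.f y = S'.f y) (hl : ∀ X Y, S.lam X Y = S'.lam X Y) (X : G₁.g) :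
    γ (isoOfEq S S' hφ hf hl).inv X = 0 :=
  γ_homOfEq S' S (fun X => (hφ X).symm) (fun y => (hf y).symm) (fun X Y => (hl X Y).symm) X

/-- The left whiskering `[a, b] ↦ [a, σ b]`. -/
def whiskerLeft (S : SecButterfly G₁ G₂) {S' S'' : SecButterfly G₂ G₃} (σ : S' ⟶ S'') :
    S.comp S' ⟶ S.comp S'' :=
  Butterfly.whiskerLeft S.B σ

/-- The right whiskering `[a, b] ↦ [σ a, b]`. -/
def whiskerRight {S S' : SecButterfly G₁ G₂} (σ : S ⟶ S') (S'' : SecButterfly G₂ G₃) :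
    S.comp S'' ⟶ S'.comp S'' :=
  Butterfly.whiskerRight σ S''.B

@[simp] theorem γ_whiskerLeft (S : SecButterfly G₁ G₂) {S' S'' : SecButterfly G₂ G₃}
    (σ : S' ⟶ S'') (X : G₁.g) : γ (S.whiskerLeft σ) X = γ σ (S.φ X) := by
  have h : (S.comp S'').q X - homMap (S.whiskerLeft σ) ((S.comp S').q X) =
      Butterfly.cls S.B S''.B
      (Butterfly.pair S.B S''.B (S.q X) (S''.q (S.φ X)) (S''.r₁_q _).symm -
        Butterfly.pair S.B S''.B (S.q X) (homMap σ (S'.q (S.φ X))) (by simp [φ_apply])) :=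
    (map_sub (Butterfly.cls S.B S''.B) _ _).symm
  rw [γ_apply, h, comp_j, γ_apply]
  change S''.j (S''.q (S.φ X) - homMap σ (S'.q (S.φ X)) - S''.B.i₁ (S.j (S.q X - S.q X))) = _
  simp

@[simp] theorem γ_whiskerRight {S S' : SecButterfly G₁ G₂} (σ : S ⟶ S')
    (S'' : SecButterfly G₂ G₃) (X : G₁.g) : γ (whiskerRight σ S'') X = S''.f (γ σ X) := by
  have h : (S'.comp S'').q X - homMap (whiskerRight σ S'') ((S.comp S'').q X) =
      Butterfly.cls S'.B S''.B
      (Butterfly.pair S'.B S''.B (S'.q X) (S''.q (S'.φ X)) (S''.r₁_q _).symm -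
        Butterfly.pair S'.B S''.B (homMap σ (S.q X)) (S''.q (S.φ X)) (by simp [φ_apply])) :=
    (map_sub (Butterfly.cls S'.B S''.B) _ _).symm
  rw [γ_apply, h, comp_j]
  change S''.j (S''.q (S'.φ X) - S''.q (S.φ X)
    - S''.B.i₁ (S'.j (S'.q X - homMap σ (S.q X)))) = _
  rw [map_sub, map_sub, j_q, j_q, f_apply, γ_apply]
  simp

/-- The associator `[[a, b], c] ↦ [a, [b, c]]`. -/
noncomputable def assoc (S : SecButterfly G₁ G₂) (S' : SecButterfly G₂ G₃)
    (S'' : SecButterfly G₃ G₄) : (S.comp S').comp S'' ≅ S.comp (S'.comp S'') :=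
  isoOfEq _ _ (fun X => by simp) (fun y => by simp) (fun X Y => by simp [add_assoc])

/-- The left unitor `[(y, X), x] ↦ x - i₁ y`. -/
noncomputable def leftUnitor (S : SecButterfly G₁ G₂) : (id G₁).comp S ≅ S :=
  isoOfEq _ _ (fun X => by simp) (fun y => by simp) (fun X Y => by simp)

/-- The right unitor `[x, (y, X)] ↦ x + i₂ y`. -/
noncomputable def rightUnitor (S : SecButterfly G₁ G₂) : S.comp (id G₂) ≅ S :=
  isoOfEq _ _ (fun X => by simp) (fun y => by simp) (fun X Y => by simp)

section

variable (S : SecButterfly G₁ G₂) (S' : SecButterfly G₂ G₃) (S'' : SecButterfly G₃ G₄)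

@[simp] theorem γ_assoc_hom (X : G₁.g) : γ (assoc S S' S'').hom X = 0 := γ_isoOfEq_hom _ _ _ _ _ X
@[simp] theorem γ_assoc_inv (X : G₁.g) : γ (assoc S S' S'').inv X = 0 := γ_isoOfEq_inv _ _ _ _ _ X
@[simp] theorem γ_leftUnitor_hom (X : G₁.g) : γ (leftUnitor S).hom X = 0 :=
  γ_isoOfEq_hom _ _ _ _ _ X
@[simp] theorem γ_leftUnitor_inv (X : G₁.g) : γ (leftUnitor S).inv X = 0 :=
  γ_isoOfEq_inv _ _ _ _ _ X
@[simp] theorem γ_rightUnitor_hom (X : G₁.g) : γ (rightUnitor S).hom X = 0 :=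
  γ_isoOfEq_hom _ _ _ _ _ X
@[simp] theorem γ_rightUnitor_inv (X : G₁.g) : γ (rightUnitor S).inv X = 0 :=
  γ_isoOfEq_inv _ _ _ _ _ X

open Butterfly in
theorem assoc_hom_cls (a : S.B.k) (b : S'.B.k) (c : S''.B.k) (h : S.B.r₂ a = S'.B.r₁ b)
    (h' : S'.B.r₂ b = S''.B.r₁ c) :
    homMap (assoc S S' S'').hom (cls (S.B.comp S'.B) S''.B
      (pair (S.B.comp S'.B) S''.B (cls S.B S'.B (pair S.B S'.B a b h)) c h')) =
    cls S.B (S'.B.comp S''.B)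
      (pair S.B (S'.B.comp S''.B) a (cls S'.B S''.B (pair S'.B S''.B b c h')) h) := by
  refine (S.comp (S'.comp S'')).k_ext (r₁_homMap _ _) ?_
  refine (j_homMap _ _).trans ?_
  rw [γ_assoc_hom, sub_zero]
  refine ((S.comp S').comp_j S'' _).trans (Eq.trans ?_ (S.comp_j (S'.comp S'') _).symm)
  change S''.j (c - S''.B.i₁ ((S.comp S').j (cls S.B S'.B (pair S.B S'.B a b h)))) =
    (S'.comp S'').j (cls S'.B S''.B (pair S'.B S''.B b c h') -
      cls S'.B S''.B (pair S'.B S''.B (S'.B.i₁ (S.j a)) 0 (by simp)))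
  rw [comp_j, ← map_sub, comp_j]
  change S''.j (c - S''.B.i₁ (S'.j (b - S'.B.i₁ (S.j a)))) =
    S''.j (c - 0 - S''.B.i₁ (S'.j (b - S'.B.i₁ (S.j a))))
  rw [sub_zero]

open Butterfly in
theorem leftUnitor_hom_cls (y : G₁.h) (X : G₁.g) (x : S.B.k) (h : G₁.t y + X = S.B.r₁ x) :
    homMap (leftUnitor S).hom (cls (Butterfly.id G₁) S.B
      (pair (Butterfly.id G₁) S.B (sd y X) x h)) = x - S.B.i₁ y := by
  refine S.k_ext ?_ ?_
  · refine (r₁_homMap _ _).trans ?_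
    rw [map_sub, ← h, Butterfly.r₁_i₁]
    change X = _
    abel
  · refine (j_homMap _ _).trans ?_
    rw [γ_leftUnitor_hom, sub_zero]
    refine ((SecButterfly.id G₁).comp_j S _).trans ?_
    change S.j (x - S.B.i₁ ((SecButterfly.id G₁).j (sd y X))) = _
    rw [id_j]

open Butterfly in
theorem rightUnitor_hom_cls (x : S.B.k) (y : G₂.h) (X : G₂.g) (h : S.B.r₂ x = X) :
    homMap (rightUnitor S).hom (cls S.B (Butterfly.id G₂)
      (pair S.B (Butterfly.id G₂) x (sd y X) h)) = x + S.B.i₂ y := by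
  refine S.k_ext ?_ ?_
  · refine (r₁_homMap _ _).trans ?_
    rw [map_add, Butterfly.r₁_i₂, add_zero]
    rfl
  · refine (j_homMap _ _).trans ?_
    rw [γ_rightUnitor_hom, sub_zero]
    refine (S.comp_j (SecButterfly.id G₂) _).trans ?_
    change (SecButterfly.id G₂).j (sd y X - sd (-S.j x) (G₂.t (S.j x))) = _
    refine (map_sub (SecButterfly.id G₂).j _ _).trans ?_
    refine (congrArg₂ (fun a b => a - b) (id_j G₂ y X) (id_j G₂ _ _)).trans ?_
    rw [map_add, j_i₂]
    abel

end

end SecButterfly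

open SecButterfly in
/-- The bicategory of central crossed modules, invertible butterflies with sections, and all
morphisms of butterflies. -/
noncomputable instance : Bicategory.{u, u + 1} CrMod.{u} where
  Hom G₁ G₂ := SecButterfly G₁ G₂
  id G := SecButterfly.id G
  comp S S' := S.comp S'
  homCategory _ _ := SecButterfly.category
  whiskerLeft S _ _ σ := SecButterfly.whiskerLeft S σ
  whiskerRight σ S := SecButterfly.whiskerRight σ S
  associator S S' S'' := assoc S S' S''
  leftUnitor S := SecButterfly.leftUnitor S
  rightUnitor S := SecButterfly.rightUnitor S
  whiskerLeft_id _ _ := hom_ext fun X => by simp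
  whiskerLeft_comp _ _ _ _ _ _ := hom_ext fun X => by simp
  id_whiskerLeft _ := hom_ext fun X => by simp
  comp_whiskerLeft _ _ _ _ _ := hom_ext fun X => by simp
  id_whiskerRight _ _ := hom_ext fun X => by simp
  comp_whiskerRight _ _ _ := hom_ext fun X => by simp
  whiskerRight_id _ := hom_ext fun X => by simp
  whiskerRight_comp _ _ _ := hom_ext fun X => by simp
  whisker_assoc _ _ _ _ _ := hom_ext fun X => by simp
  whisker_exchange σ τ := hom_ext fun X => by simp [f_γ τ, φ_γ σ]; abel
  pentagon _ _ _ _ := hom_ext fun X => by simp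
  triangle _ _ := hom_ext fun X => by simp

/-! ### The groupoid of infinitesimal adjustments -/

/-- An infinitesimal adjustment on a crossed module. -/
structure InfAdj (G : CrMod.{u}) : Type u where
  toLin : G.g →ₗ[ℝ] G.g →ₗ[ℝ] G.h
  continuous_toLin : Continuous fun x : G.g × G.g => toLin x.1 x.2
  lie_rule : ∀ X Y Z, toLin ⁅X, Y⁆ Z + toLin Y ⁅X, Z⁆ = toLin X ⁅Y, Z⁆
  t_left : ∀ x Y, toLin (G.t x) Y = -G.α Y x
  t_right : ∀ X y, toLin X (G.t y) = G.α X y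

/-- The infinitesimal adjustment `η` is adapted to the section `s` if `t η (X, Y) = ρ [X, Y]`,
where `ρ = id - s p`. -/
def InfAdj.IsAdapted {G : CrMod.{u}} (η : InfAdj G) (s : G.f →L[ℝ] G.g) : Prop :=
  ∀ X Y, G.t (η.toLin X Y) = ⁅X, Y⁆ - s (G.p ⁅X, Y⁆)

/-- The objects of the groupoid of infinitesimal adjustments: pairs `(s, η)` of a section `s` and
an infinitesimal adjustment `η` that is adapted to `s`. -/
structure Adj (G : CrMod.{u}) : Type u where
  s : G.f →L[ℝ] G.g
  p_s : ∀ a, G.p (s a) = a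
  η : InfAdj G
  adapted : η.IsAdapted s

namespace Adj

variable {G : CrMod.{u}}

attribute [simp] p_s

theorem ext {a b : Adj G} (hs : ∀ x, a.s x = b.s x)
    (hη : ∀ X Y, a.η.toLin X Y = b.η.toLin X Y) : a = b := by
  obtain ⟨s, _, ⟨η, _, _, _, _⟩, _⟩ := a
  obtain ⟨s', _, ⟨η', _, _, _, _⟩, _⟩ := b
  obtain rfl : s = s' := ContinuousLinearMap.ext hs
  obtain rfl : η = η' := LinearMap.ext₂ hη
  rfl

/-- A morphism `(s, η) → (s', η')` is a continuous linear map `φ : 𝔣 → 𝔥` such that `s' - s = t φ`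
and `η' - η = δ (p* φ)`, where `δ (p* φ) (X, Y) = -φ (p [X, Y])` is the Chevalley-Eilenberg
differential. -/
@[ext] structure Hom (a b : Adj G) : Type u where
  toCLM : G.f →L[ℝ] G.h
  s_sub_s : ∀ x, b.s x - a.s x = G.t (toCLM x)
  η_sub_η : ∀ X Y, b.η.toLin X Y - a.η.toLin X Y = -toCLM (G.p ⁅X, Y⁆)

/-- The groupoid of infinitesimal adjustments; composition is addition. -/
instance : Groupoid.{u, u} (Adj G) where
  Hom a b := Hom a b
  id a := ⟨0, by simp, by simp⟩
  comp φ ψ := ⟨φ.toCLM + ψ.toCLM, fun x => by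
      simp only [_root_.add_apply, map_add, ← φ.s_sub_s, ← ψ.s_sub_s]; abel,
    fun X Y => by
      have h₁ := φ.η_sub_η X Y
      have h₂ := ψ.η_sub_η X Y
      rw [_root_.add_apply, neg_add, ← h₁, ← h₂]; abel⟩
  id_comp φ := Hom.ext (zero_add φ.toCLM)
  comp_id φ := Hom.ext (add_zero φ.toCLM)
  assoc φ ψ χ := Hom.ext (add_assoc φ.toCLM ψ.toCLM χ.toCLM)
  inv φ := ⟨-φ.toCLM, fun x => by
      simp only [_root_.neg_apply, map_neg, ← φ.s_sub_s]; abel,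
    fun X Y => by
      have h := φ.η_sub_η X Y
      rw [_root_.neg_apply, ← h]; abel⟩
  inv_comp φ := Hom.ext (neg_add_cancel φ.toCLM)
  comp_inv φ := Hom.ext (add_neg_cancel φ.toCLM)

/-- The continuous linear map `𝔣 → 𝔥` underlying a morphism. -/
def homCLM {a b : Adj G} (φ : a ⟶ b) : G.f →L[ℝ] G.h := Hom.toCLM φ

theorem hom_ext {a b : Adj G} {φ ψ : a ⟶ b} (h : ∀ x, homCLM φ x = homCLM ψ x) : φ = ψ :=
  Hom.ext (ContinuousLinearMap.ext h)

theorem t_homCLM {a b : Adj G} (φ : a ⟶ b) (x : G.f) : G.t (homCLM φ x) = b.s x - a.s x :=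
  (Hom.s_sub_s φ x).symm

theorem homCLM_lie {a b : Adj G} (φ : a ⟶ b) (X Y : G.g) :
    homCLM φ (G.p ⁅X, Y⁆) = a.η.toLin X Y - b.η.toLin X Y := by
  rw [← neg_sub, Hom.η_sub_η φ, neg_neg]; rfl

@[simp] theorem homCLM_id (a : Adj G) (x : G.f) : homCLM (𝟙 a) x = 0 := rfl

@[simp] theorem homCLM_comp {a b c : Adj G} (φ : a ⟶ b) (ψ : b ⟶ c) (x : G.f) :
    homCLM (φ ≫ ψ) x = homCLM φ x + homCLM ψ x := rfl

@[simp] theorem homCLM_eqToHom {a b : Adj G} (h : a = b) (x : G.f) :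
    homCLM (eqToHom h) x = 0 := by
  subst h; rfl

end Adj

/-! ### Half splittings -/

namespace CrMod

variable {G : CrMod.{u}}

/-- `u` is a half splitting that induces the section `s`, i.e. `t u = id - s p`. -/
def IsHalfSplitting (s : G.f →L[ℝ] G.g) (u : G.g →ₗ[ℝ] G.h) : Prop :=
  ∀ X, G.t (u X) = X - s (G.p X)

theorem exists_halfSplitting {s : G.f →L[ℝ] G.g} (hs : ∀ a, G.p (s a) = a) :
    ∃ u : G.g →ₗ[ℝ] G.h, IsHalfSplitting s u := by
  let T : G.h →ₗ[ℝ] LinearMap.range G.t.toCLM.toLinearMap := G.t.toCLM.toLinearMap.rangeRestrict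
  obtain ⟨v, hv⟩ := T.exists_rightInverse_of_surjective (LinearMap.range_rangeRestrict _)
  let ρ : G.g →ₗ[ℝ] LinearMap.range G.t.toCLM.toLinearMap :=
    LinearMap.codRestrict _ (LinearMap.id - s.toLinearMap.comp G.p.toLinearMap) fun X => by
      obtain ⟨y, hy⟩ := G.p_eq_zero (X := X - s (G.p X)) (by simp [hs])
      exact ⟨y, hy⟩
  refine ⟨v.comp ρ, fun X => ?_⟩
  exact congrArg Subtype.val (LinearMap.congr_fun hv (ρ X))

/-- A choice of a half splitting that induces the section `s`. -/
noncomputable def halfSplitting (s : G.f →L[ℝ] G.g) (hs : ∀ a, G.p (s a) = a) : G.g →ₗ[ℝ] G.h :=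
  (exists_halfSplitting hs).choose

theorem halfSplitting_spec (s : G.f →L[ℝ] G.g) (hs : ∀ a, G.p (s a) = a) :
    IsHalfSplitting s (halfSplitting s hs) := (exists_halfSplitting hs).choose_spec

/-- The 2-cochain `ω (X, Y) = α (X, u Y) - α (Y, u X) - [u X, u Y] + u [s p X, s p Y]` associated
to a half splitting `u` that induces the section `s`. -/
def omega (s : G.f →L[ℝ] G.g) (u : G.g →ₗ[ℝ] G.h) : G.g →ₗ[ℝ] G.g →ₗ[ℝ] G.h :=
  LinearMap.mk₂ ℝ
    (fun X Y => G.α X (u Y) - G.α Y (u X) - ⁅u X, u Y⁆ + u ⁅s (G.p X), s (G.p Y)⁆)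
    (fun X X' Y => by simp; abel) (fun c X Y => by simp [smul_sub]) (fun X Y Y' => by simp; abel)
    (fun c X Y => by simp [smul_sub])

theorem omega_apply (s : G.f →L[ℝ] G.g) (u : G.g →ₗ[ℝ] G.h) (X Y : G.g) : omega s u X Y =
    G.α X (u Y) - G.α Y (u X) - ⁅u X, u Y⁆ + u ⁅s (G.p X), s (G.p Y)⁆ := rfl

theorem omega_skew (s : G.f →L[ℝ] G.g) (u : G.g →ₗ[ℝ] G.h) (X Y : G.g) :
    omega s u X Y = -omega s u Y X := by
  rw [omega_apply, omega_apply, ← lie_skew (u X), ← lie_skew (s _), map_neg]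
  abel

theorem omega_t_right {s : G.f →L[ℝ] G.g} {u : G.g →ₗ[ℝ] G.h} (hu : IsHalfSplitting s u)
    (X : G.g) (y : G.h) : omega s u X (G.t y) = G.α X y := by
  have h : G.α X (u (G.t y) - y) = 0 := G.central _ _ (by rw [map_sub, hu]; simp)
  have h' : ⁅u (G.t y) - y, u X⁆ = 0 := by
    rw [← G.peiffer, map_sub, hu]; simp
  rw [omega_apply, p_t, map_zero, lie_zero, map_zero, add_zero, G.peiffer, ← lie_skew (u X),
    ← sub_eq_zero, ← h]
  rw [sub_lie] at h'
  rw [map_sub, sub_eq_zero.1 h']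
  abel

theorem omega_t_left {s : G.f →L[ℝ] G.g} {u : G.g →ₗ[ℝ] G.h} (hu : IsHalfSplitting s u)
    (y : G.h) (X : G.g) : omega s u (G.t y) X = -G.α X y := by
  rw [omega_skew, omega_t_right hu]

/-- A bilinear map that vanishes on `t(𝔥)` in both arguments descends along `p`. -/
theorem bilin_descends (b : G.g →ₗ[ℝ] G.g →ₗ[ℝ] G.h) (h₁ : ∀ y X, b (G.t y) X = 0)
    (h₂ : ∀ X y, b X (G.t y) = 0) {s : G.f →L[ℝ] G.g} (hs : ∀ a, G.p (s a) = a) (X Y : G.g) :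
    b (s (G.p X)) (s (G.p Y)) = b X Y := by
  obtain ⟨x, hx⟩ := G.p_eq_zero (X := X - s (G.p X)) (by simp [hs])
  obtain ⟨y, hy⟩ := G.p_eq_zero (X := Y - s (G.p Y)) (by simp [hs])
  conv_rhs => rw [← sub_add_cancel X (s (G.p X)), ← sub_add_cancel Y (s (G.p Y)), ← hx, ← hy]
  simp [h₁, h₂]

end CrMod

/-! ### The functors associated to butterflies -/

namespace SecButterfly

open CrMod

variable {G₁ G₂ G₃ : CrMod.{u}} (S : SecButterfly G₁ G₂)

theorem exists_r₂ (Z : G₂.g) : ∃ x, S.B.r₂ x = Z := by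
  obtain ⟨σ, hσ⟩ := S.invertible.2.2
  exact ⟨σ Z, hσ Z⟩

/-- A choice of a section of `r₂`. -/
noncomputable def sec₂ : G₂.g →L[ℝ] S.B.k := S.invertible.2.2.choose

@[simp] theorem r₂_sec₂ (Z : G₂.g) : S.B.r₂ (S.sec₂ Z) = Z := S.invertible.2.2.choose_spec Z

theorem p_φ_r₁ (x : S.B.k) : G₂.p (S.φ (S.B.r₁ x)) = G₂.p (S.B.r₂ x) := by
  rw [S.r₂_eq, map_add, p_t, add_zero]

theorem p_r₁_eq {x y : S.B.k} (h : G₂.p (S.B.r₂ x) = G₂.p (S.B.r₂ y)) :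
    G₁.p (S.B.r₁ x) = G₁.p (S.B.r₁ y) := by
  obtain ⟨b, hb⟩ := G₂.p_eq_zero (X := S.B.r₂ (x - y)) (by rw [map_sub, map_sub, h, sub_self])
  obtain ⟨a, ha⟩ := (S.invertible.2.1 (x - y - S.B.i₂ b)).1 (by simp [hb])
  have h' := congrArg S.B.r₁ ha
  rw [Butterfly.r₁_i₁, map_sub, map_sub, Butterfly.r₁_i₂, sub_zero] at h'
  rw [← sub_eq_zero, ← map_sub, ← h', p_t]

/-- The isomorphism `Φ : 𝔣₁ → 𝔣₂` induced by `φ : 𝔤₁ → 𝔤₂`. -/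
noncomputable def Φ : G₁.f ≃L[ℝ] G₂.f :=
  ContinuousLinearEquiv.equivOfInverse
    (G₁.fLift (G₂.p.comp S.φ) fun y => by simp [← S.t_f])
    (G₂.fLift (G₁.p.comp (S.B.r₁.toCLM.comp S.sec₂)) fun y => by
      refine (S.p_r₁_eq (x := S.sec₂ (G₂.t y)) (y := 0) ?_).trans (by simp)
      simp)
    (fun a => by
      obtain ⟨X, rfl⟩ := G₁.p_surjective a
      refine (S.p_r₁_eq (x := S.sec₂ (S.φ X)) (y := S.q X) ?_).trans (by simp)
      rw [r₂_sec₂, φ_apply])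
    (fun a => by
      obtain ⟨Z, rfl⟩ := G₂.p_surjective a
      refine (S.p_φ_r₁ (S.sec₂ Z)).trans (by simp))

theorem Φ_p (X : G₁.g) : S.Φ (G₁.p X) = G₂.p (S.φ X) := rfl

theorem Φ_p_r₁ (x : S.B.k) : S.Φ (G₁.p (S.B.r₁ x)) = G₂.p (S.B.r₂ x) := S.p_φ_r₁ x

@[simp] theorem Φ_symm_p_r₂ (x : S.B.k) : S.Φ.symm (G₂.p (S.B.r₂ x)) = G₁.p (S.B.r₁ x) := by
  rw [← Φ_p_r₁, ContinuousLinearEquiv.symm_apply_apply]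

/-- The section `s₂ = φ s₁ Φ⁻¹`. -/
noncomputable def pushSec (s₁ : G₁.f →L[ℝ] G₁.g) : G₂.f →L[ℝ] G₂.g :=
  S.φ.comp (s₁.comp S.Φ.symm.toContinuousLinearMap)

theorem pushSec_apply (s₁ : G₁.f →L[ℝ] G₁.g) (a : G₂.f) :
    S.pushSec s₁ a = S.φ (s₁ (S.Φ.symm a)) := rfl

theorem p_pushSec {s₁ : G₁.f →L[ℝ] G₁.g} (hs : ∀ a, G₁.p (s₁ a) = a) (a : G₂.f) :
    G₂.p (S.pushSec s₁ a) = a := by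
  rw [pushSec_apply, ← Φ_p, hs, ContinuousLinearEquiv.apply_symm_apply]

/-- The bilinear form `β` on `𝔣₁` with `p₁* β = η₁ - ω₁`. -/
noncomputable def beta (a : Adj G₁) (u₁ : G₁.g →ₗ[ℝ] G₁.h) : G₁.f →ₗ[ℝ] G₁.f →ₗ[ℝ] G₁.h :=
  (a.η.toLin - omega a.s u₁).compl₁₂ a.s.toLinearMap a.s.toLinearMap

theorem beta_p (a : Adj G₁) {u₁ : G₁.g →ₗ[ℝ] G₁.h} (hu₁ : IsHalfSplitting a.s u₁) (X Y : G₁.g) :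
    beta a u₁ (G₁.p X) (G₁.p Y) = a.η.toLin X Y - omega a.s u₁ X Y :=
  bilin_descends (a.η.toLin - omega a.s u₁)
    (fun y X => by simp [a.η.t_left, omega_t_left hu₁])
    (fun X y => by simp [a.η.t_right, omega_t_right hu₁]) a.p_s X Y

/-- The 2-cochain `R' = φ* ω₂ - f ω₁ - λ` on `𝔤₁`. -/
noncomputable def R' (s₁ : G₁.f →L[ℝ] G₁.g) (u₁ : G₁.g →ₗ[ℝ] G₁.h) (u₂ : G₂.g →ₗ[ℝ] G₂.h) :
    G₁.g →ₗ[ℝ] G₁.g →ₗ[ℝ] G₂.h :=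
  (omega (S.pushSec s₁) u₂).compl₁₂ S.φ.toLinearMap S.φ.toLinearMap -
    (omega s₁ u₁).compr₂ S.f.toLinearMap - S.lam

theorem R'_apply (s₁ : G₁.f →L[ℝ] G₁.g) (u₁ : G₁.g →ₗ[ℝ] G₁.h) (u₂ : G₂.g →ₗ[ℝ] G₂.h)
    (X Y : G₁.g) : S.R' s₁ u₁ u₂ X Y =
      omega (S.pushSec s₁) u₂ (S.φ X) (S.φ Y) - S.f (omega s₁ u₁ X Y) - S.lam X Y := rfl

/-- The 2-cochain `R` on `𝔣₁` with `p₁* R = R'`. -/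
noncomputable def R (s₁ : G₁.f →L[ℝ] G₁.g) (u₁ : G₁.g →ₗ[ℝ] G₁.h) (u₂ : G₂.g →ₗ[ℝ] G₂.h) :
    G₁.f →ₗ[ℝ] G₁.f →ₗ[ℝ] G₂.h :=
  (S.R' s₁ u₁ u₂).compl₁₂ s₁.toLinearMap s₁.toLinearMap

theorem R'_t_right {s₁ : G₁.f →L[ℝ] G₁.g} {u₁ : G₁.g →ₗ[ℝ] G₁.h} {u₂ : G₂.g →ₗ[ℝ] G₂.h}
    (hu₁ : IsHalfSplitting s₁ u₁) (hu₂ : IsHalfSplitting (S.pushSec s₁) u₂) (X : G₁.g)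
    (y : G₁.h) : S.R' s₁ u₁ u₂ X (G₁.t y) = 0 := by
  rw [R'_apply, ← S.t_f, omega_t_right hu₁, omega_t_right hu₂, α_f]
  abel

theorem R'_skew (s₁ : G₁.f →L[ℝ] G₁.g) (u₁ : G₁.g →ₗ[ℝ] G₁.h) (u₂ : G₂.g →ₗ[ℝ] G₂.h)
    (X Y : G₁.g) : S.R' s₁ u₁ u₂ X Y = -S.R' s₁ u₁ u₂ Y X := by
  rw [R'_apply, R'_apply, omega_skew _ u₂, omega_skew _ u₁, lam_skew, map_neg]
  abel

theorem R_p {s₁ : G₁.f →L[ℝ] G₁.g} (hs : ∀ a, G₁.p (s₁ a) = a) {u₁ : G₁.g →ₗ[ℝ] G₁.h}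
    {u₂ : G₂.g →ₗ[ℝ] G₂.h} (hu₁ : IsHalfSplitting s₁ u₁)
    (hu₂ : IsHalfSplitting (S.pushSec s₁) u₂) (X Y : G₁.g) :
    S.R s₁ u₁ u₂ (G₁.p X) (G₁.p Y) = S.R' s₁ u₁ u₂ X Y := by
  refine (congrArg (fun x => x) ?_ : (S.R' s₁ u₁ u₂) (s₁ (G₁.p X)) (s₁ (G₁.p Y)) = _)
  obtain ⟨x, hx⟩ := G₁.p_eq_zero (X := X - s₁ (G₁.p X)) (by simp [hs])
  obtain ⟨y, hy⟩ := G₁.p_eq_zero (X := Y - s₁ (G₁.p Y)) (by simp [hs])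
  have h₁ := S.R'_t_right hu₁ hu₂
  have h₂ : ∀ y X, S.R' s₁ u₁ u₂ (G₁.t y) X = 0 := fun y X => by rw [R'_skew, h₁, neg_zero]
  conv_rhs => rw [← sub_add_cancel X (s₁ (G₁.p X)), ← sub_add_cancel Y (s₁ (G₁.p Y)), ← hx, ← hy]
  simp only [map_add, LinearMap.add_apply, h₁, h₂, zero_add]

/-- The bilinear map `η₂ = ω₂ + p₂* (Φ⁻¹)* (f β - R)`. -/
noncomputable def pushLin (a : Adj G₁) (u₁ : G₁.g →ₗ[ℝ] G₁.h) (u₂ : G₂.g →ₗ[ℝ] G₂.h) :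
    G₂.g →ₗ[ℝ] G₂.g →ₗ[ℝ] G₂.h :=
  omega (S.pushSec a.s) u₂ +
    ((beta a u₁).compr₂ S.f.toLinearMap - S.R a.s u₁ u₂).compl₁₂
      (S.Φ.symm.toLinearMap.comp G₂.p.toLinearMap) (S.Φ.symm.toLinearMap.comp G₂.p.toLinearMap)

theorem pushLin_apply (a : Adj G₁) (u₁ : G₁.g →ₗ[ℝ] G₁.h) (u₂ : G₂.g →ₗ[ℝ] G₂.h) (X Y : G₂.g) :
    S.pushLin a u₁ u₂ X Y = omega (S.pushSec a.s) u₂ X Y +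
      (S.f (beta a u₁ (S.Φ.symm (G₂.p X)) (S.Φ.symm (G₂.p Y))) -
        S.R a.s u₁ u₂ (S.Φ.symm (G₂.p X)) (S.Φ.symm (G₂.p Y))) := rfl

theorem pushLin_r₂ (a : Adj G₁) {u₁ : G₁.g →ₗ[ℝ] G₁.h} {u₂ : G₂.g →ₗ[ℝ] G₂.h}
    (hu₁ : IsHalfSplitting a.s u₁) (hu₂ : IsHalfSplitting (S.pushSec a.s) u₂) (x y : S.B.k) :
    S.pushLin a u₁ u₂ (S.B.r₂ x) (S.B.r₂ y) =
      S.f (a.η.toLin (S.B.r₁ x) (S.B.r₁ y)) + S.j ⁅x, y⁆ := by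
  rw [pushLin_apply, Φ_symm_p_r₂, Φ_symm_p_r₂, beta_p a hu₁, S.R_p a.p_s hu₁ hu₂, R'_apply, j_lie,
    S.r₂_eq x, S.r₂_eq y]
  simp only [map_add, map_sub, LinearMap.add_apply, omega_t_left hu₂, omega_t_right hu₂, G₂.peiffer]
  rw [← lie_skew (S.j x) (S.j y)]
  abel

/-- The bilinear map `η₂` does not depend on the choice of the half splittings. -/
theorem pushLin_eq (a : Adj G₁) {u₁ u₁' : G₁.g →ₗ[ℝ] G₁.h} {u₂ u₂' : G₂.g →ₗ[ℝ] G₂.h}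
    (hu₁ : IsHalfSplitting a.s u₁) (hu₂ : IsHalfSplitting (S.pushSec a.s) u₂)
    (hu₁' : IsHalfSplitting a.s u₁') (hu₂' : IsHalfSplitting (S.pushSec a.s) u₂') :
    S.pushLin a u₁ u₂ = S.pushLin a u₁' u₂' := by
  refine LinearMap.ext₂ fun X Y => ?_
  obtain ⟨x, rfl⟩ := S.exists_r₂ X
  obtain ⟨y, rfl⟩ := S.exists_r₂ Y
  rw [S.pushLin_r₂ a hu₁ hu₂, S.pushLin_r₂ a hu₁' hu₂']

/-- The map on objects, `(s₁, η₁) ↦ (s₂, η₂)`. -/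
noncomputable def adjObj (a : Adj G₁) : Adj G₂ :=
  have key := S.pushLin_r₂ a (halfSplitting_spec a.s a.p_s)
    (halfSplitting_spec (S.pushSec a.s) (S.p_pushSec a.p_s))
  { s := S.pushSec a.s
    p_s := S.p_pushSec a.p_s
    η :=
      { toLin := S.pushLin a (halfSplitting a.s a.p_s)
          (halfSplitting (S.pushSec a.s) (S.p_pushSec a.p_s))
        continuous_toLin := by
          have h : ∀ x : G₂.g × G₂.g, S.pushLin a (halfSplitting a.s a.p_s)
              (halfSplitting (S.pushSec a.s) (S.p_pushSec a.p_s)) x.1 x.2 =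
              S.f (a.η.toLin (S.B.r₁ (S.sec₂ x.1)) (S.B.r₁ (S.sec₂ x.2)))
                + S.j ⁅S.sec₂ x.1, S.sec₂ x.2⁆ := fun x => by
            rw [← key, r₂_sec₂, r₂_sec₂]
          refine Continuous.congr (Continuous.add ?_ ?_) fun x => (h x).symm
          · exact S.f.continuous.comp (a.η.continuous_toLin.comp
              (f := fun x : G₂.g × G₂.g => (S.B.r₁ (S.sec₂ x.1), S.B.r₁ (S.sec₂ x.2)))
              (by fun_prop))
          · exact S.j.continuous.comp (S.B.k.continuous_lie.comp
              (f := fun x : G₂.g × G₂.g => (S.sec₂ x.1, S.sec₂ x.2)) (by fun_prop))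
        lie_rule := fun X Y Z => by
          obtain ⟨x, rfl⟩ := S.exists_r₂ X
          obtain ⟨y, rfl⟩ := S.exists_r₂ Y
          obtain ⟨z, rfl⟩ := S.exists_r₂ Z
          rw [← LCLieHom.map_lie, ← LCLieHom.map_lie, ← LCLieHom.map_lie, key, key, key,
            LCLieHom.map_lie, LCLieHom.map_lie, LCLieHom.map_lie, ← a.η.lie_rule (S.B.r₁ x),
            leibniz_lie x y z]
          simp only [map_add]
          abel
        t_left := fun b Y => by
          obtain ⟨y, rfl⟩ := S.exists_r₂ Y
          rw [← S.B.r₂_i₂, key, Butterfly.r₁_i₂, map_zero, LinearMap.zero_apply, map_zero, zero_add,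
            ← lie_skew, ← S.B.i₂_α, map_neg, j_i₂]
        t_right := fun X b => by
          obtain ⟨x, rfl⟩ := S.exists_r₂ X
          rw [← S.B.r₂_i₂, key, Butterfly.r₁_i₂, map_zero, map_zero, zero_add, ← S.B.i₂_α, j_i₂] }
    adapted := fun X Y => by
      obtain ⟨x, rfl⟩ := S.exists_r₂ X
      obtain ⟨y, rfl⟩ := S.exists_r₂ Y
      rw [key, map_add, S.t_f, a.adapted, ← LCLieHom.map_lie, ← LCLieHom.map_lie, map_sub,
        pushSec_apply, Φ_symm_p_r₂]
      rw [S.r₂_eq ⁅x, y⁆]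
      abel }

theorem adjObj_s (a : Adj G₁) (x : G₂.f) : (S.adjObj a).s x = S.φ (a.s (S.Φ.symm x)) := rfl

theorem adjObj_η (a : Adj G₁) (x y : S.B.k) :
    (S.adjObj a).η.toLin (S.B.r₂ x) (S.B.r₂ y) =
      S.f (a.η.toLin (S.B.r₁ x) (S.B.r₁ y)) + S.j ⁅x, y⁆ :=
  S.pushLin_r₂ a (halfSplitting_spec a.s a.p_s)
    (halfSplitting_spec (S.pushSec a.s) (S.p_pushSec a.p_s)) x y

/-- The map on morphisms, `φ ↦ f φ Φ⁻¹`. -/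
noncomputable def adjMap {a b : Adj G₁} (χ : a ⟶ b) : S.adjObj a ⟶ S.adjObj b :=
  Adj.Hom.mk (S.f.comp ((Adj.homCLM χ).comp S.Φ.symm.toContinuousLinearMap))
    (fun x => by
      rw [adjObj_s, adjObj_s, ← map_sub, ← Adj.t_homCLM χ, ← S.t_f]
      rfl)
    (fun X Y => by
      obtain ⟨x, rfl⟩ := S.exists_r₂ X
      obtain ⟨y, rfl⟩ := S.exists_r₂ Y
      have h : S.f (Adj.homCLM χ (S.Φ.symm (G₂.p ⁅S.B.r₂ x, S.B.r₂ y⁆))) =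
          S.f (a.η.toLin (S.B.r₁ x) (S.B.r₁ y)) - S.f (b.η.toLin (S.B.r₁ x) (S.B.r₁ y)) := by
        rw [← LCLieHom.map_lie, Φ_symm_p_r₂, LCLieHom.map_lie, Adj.homCLM_lie, map_sub]
      rw [adjObj_η, adjObj_η]
      refine Eq.trans ?_ (congrArg Neg.neg h).symm
      abel)

@[simp] theorem homCLM_adjMap {a b : Adj G₁} (χ : a ⟶ b) (x : G₂.f) :
    Adj.homCLM (S.adjMap χ) x = S.f (Adj.homCLM χ (S.Φ.symm x)) := rfl

/-- The functor between the groupoids of infinitesimal adjustments associated to an invertible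
butterfly with a section. -/
noncomputable def adjFunctor : Adj G₁ ⥤ Adj G₂ where
  obj a := S.adjObj a
  map χ := S.adjMap χ
  map_id a := Adj.hom_ext fun x => by simp
  map_comp χ ψ := Adj.hom_ext fun x => by simp

section nat

variable {S} {S' : SecButterfly G₁ G₂} (σ : S ⟶ S')

theorem Φ_eq (σ : S ⟶ S') (a : G₂.f) : S.Φ.symm a = S'.Φ.symm a := by
  obtain ⟨X, rfl⟩ := G₂.p_surjective a
  obtain ⟨x, rfl⟩ := S.exists_r₂ X
  rw [Φ_symm_p_r₂, ← r₂_homMap σ x, Φ_symm_p_r₂, r₁_homMap]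

/-- The component `γ s Φ⁻¹` at `(s, η)` of the natural transformation associated to a morphism of
butterflies. -/
noncomputable def adjApp (a : Adj G₁) : S.adjObj a ⟶ S'.adjObj a :=
  Adj.Hom.mk ((γ σ).comp (a.s.comp S.Φ.symm.toContinuousLinearMap))
    (fun x => by
      rw [adjObj_s, adjObj_s, φ_γ σ, Φ_eq σ]
      refine (add_sub_cancel_left _ _).trans ?_
      change _ = G₂.t (γ σ (a.s (S.Φ.symm x)))
      rw [Φ_eq σ])
    (fun X Y => by
      obtain ⟨x, rfl⟩ := S.exists_r₂ X
      obtain ⟨y, rfl⟩ := S.exists_r₂ Y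
      have h := S'.adjObj_η a (homMap σ x) (homMap σ y)
      rw [r₂_homMap, r₂_homMap, r₁_homMap, r₁_homMap, ← LCLieHom.map_lie, j_homMap, f_γ σ,
        a.adapted, LCLieHom.map_lie] at h
      have h' : γ σ (a.s (S.Φ.symm (G₂.p ⁅S.B.r₂ x, S.B.r₂ y⁆))) =
          γ σ (a.s (G₁.p ⁅S.B.r₁ x, S.B.r₁ y⁆)) := by
        rw [← LCLieHom.map_lie, Φ_symm_p_r₂, LCLieHom.map_lie]
      rw [h, adjObj_η]
      refine Eq.trans ?_ (congrArg Neg.neg h').symm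
      rw [map_sub]
      abel)

@[simp] theorem homCLM_adjApp (a : Adj G₁) (x : G₂.f) :
    Adj.homCLM (adjApp σ a) x = γ σ (a.s (S.Φ.symm x)) := rfl

/-- The natural transformation associated to a morphism of butterflies. -/
noncomputable def adjNat : S.adjFunctor ⟶ S'.adjFunctor where
  app a := adjApp σ a
  naturality a b χ := Adj.hom_ext fun x => by
    refine (Adj.homCLM_comp _ _ _).trans (Eq.trans ?_ (Adj.homCLM_comp _ _ _).symm)
    change S.f (Adj.homCLM χ (S.Φ.symm x)) + γ σ (b.s (S.Φ.symm x)) =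
      γ σ (a.s (S.Φ.symm x)) + S'.f (Adj.homCLM χ (S'.Φ.symm x))
    rw [← Φ_eq σ, f_γ σ, Adj.t_homCLM, map_sub]
    abel

end nat

end SecButterfly

/-! ### The 2-functor -/

/-- The strict 2-category of groupoids, functors and natural transformations. -/
instance : Bicategory.{u, u} Grpd.{u, u} where
  toCategoryStruct := Grpd.category.toCategoryStruct
  homCategory C D := inferInstanceAs (Category (C ⥤ D))
  whiskerLeft F _ _ τ := Functor.whiskerLeft F τ
  whiskerRight τ H := Functor.whiskerRight τ H
  associator F G H := Functor.associator F G H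
  leftUnitor F := Functor.leftUnitor F
  rightUnitor F := Functor.rightUnitor F
  whiskerLeft_id _ _ := by apply NatTrans.ext; funext x; rfl
  whiskerLeft_comp _ _ _ _ _ _ := by apply NatTrans.ext; funext x; rfl
  id_whiskerLeft τ := by
    apply NatTrans.ext; funext x
    exact (show τ.app x = 𝟙 _ ≫ τ.app x ≫ 𝟙 _ by rw [Category.id_comp, Category.comp_id])
  comp_whiskerLeft F G _ _ τ := by
    apply NatTrans.ext; funext x
    exact (show τ.app (G.obj (F.obj x)) = 𝟙 _ ≫ τ.app (G.obj (F.obj x)) ≫ 𝟙 _ by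
      rw [Category.id_comp, Category.comp_id])
  id_whiskerRight F G := by
    apply NatTrans.ext; funext x
    exact G.map_id (F.obj x)
  comp_whiskerRight τ τ' G := by
    apply NatTrans.ext; funext x
    exact G.map_comp (τ.app x) (τ'.app x)
  whiskerRight_id τ := by
    apply NatTrans.ext; funext x
    exact (show τ.app x = 𝟙 _ ≫ τ.app x ≫ 𝟙 _ by rw [Category.id_comp, Category.comp_id])
  whiskerRight_comp τ G H := by
    apply NatTrans.ext; funext x
    exact (show H.map (G.map (τ.app x)) = 𝟙 _ ≫ H.map (G.map (τ.app x)) ≫ 𝟙 _ by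
      rw [Category.id_comp, Category.comp_id])
  whisker_assoc F _ _ τ H := by
    apply NatTrans.ext; funext x
    exact (show H.map (τ.app (F.obj x)) = 𝟙 _ ≫ H.map (τ.app (F.obj x)) ≫ 𝟙 _ by
      rw [Category.id_comp, Category.comp_id])
  whisker_exchange τ τ' := by
    apply NatTrans.ext; funext x
    exact (τ'.naturality (τ.app x)).symm
  pentagon F G H K := by
    apply NatTrans.ext; funext x
    exact (show K.map (𝟙 (H.obj (G.obj (F.obj x)))) ≫ 𝟙 _ ≫ 𝟙 _ = 𝟙 _ ≫ 𝟙 _ by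
      rw [_root_.CategoryTheory.Functor.map_id, Category.id_comp])
  triangle F G := by
    apply NatTrans.ext; funext x
    exact (show 𝟙 _ ≫ 𝟙 _ = G.map (𝟙 (F.obj x)) by
      rw [_root_.CategoryTheory.Functor.map_id, Category.id_comp])

/-- The assignment of the groupoids of infinitesimal adjustments to crossed modules, of their
functors to invertible butterflies with sections, and of the natural transformations to morphisms
of butterflies. -/
noncomputable def adjSec : PrelaxFunctorStruct CrMod.{u} Grpd.{u, u} where
  obj G := Grpd.of (Adj G)
  map S := SecButterfly.adjFunctor S
  map₂ σ := SecButterfly.adjNat σ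

/-- Two crossed modules are weakly equivalent if there exists an invertible butterfly between
them. -/
def WeaklyEquivalent (G₁ G₂ : CrMod.{u}) : Prop := ∃ B : Butterfly G₁ G₂, B.IsInvertible

/-! ### Strictness on objects and morphisms -/

/-! The definition of `η₂` through half splittings, `β` and `R` is hard to compose, but the
butterfly carries a description free of choices. By `adjObj_η`, `η₂ (r₂ x, r₂ y) = f η₁ (r₁ x, r₁ y)
+ j [x, y]` for `x, y` in `𝔨`. Since `r₂` is surjective, this determines `η₂`. In the same way
`Φ_symm_p_r₂`, that is `Φ⁻¹ p₂ r₂ = p₁ r₁`, determines `Φ⁻¹`. Strictness on objects therefore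
becomes a computation with representatives in `𝔨`: for the identity with the lifts `(0, X)`, whose
brackets `j` kills, and for a composite with classes `[x, y]`, on which `j` is given by `comp_j`.
The sections and the morphisms follow from the multiplicativity of `φ`, `f` and `Φ⁻¹`. This yields
`adjFunctor_id` and `adjFunctor_comp`.

On 2-morphisms everything is linear. A morphism of adjustments is determined by a map `𝔣 → 𝔥`,
composition is addition, and identities and transports along equalities have underlying map `0`.
Each law of a strict pseudofunctor is thus an identity between linear maps. Those needed are that
`γ` is additive under vertical composition, that whiskering turns `γ` into `γ φ` or `f γ`, and that
associators and unitors have `γ = 0`. The two whiskering rules match exactly because sections are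
pushed forward by `φ s Φ⁻¹` and morphisms by `f φ Φ⁻¹`.

For the equivalence of groupoids, an invertible butterfly is read backwards, after choosing a
section `q` of `r₂`. Its functor and the original one are mutually inverse up to the natural
isomorphism with components `j q s`. This rests on `f_flip_f` and `f_flip_j`, together with the
adaptedness of `η` to `s`. Since the situation is symmetric, one computation serves both the unit
and the counit. -/

/-- Equality of functors usually compares morphisms only after conjugation with `eqToHom`. Here that
conjugation adds zero on both sides, so the underlying linear maps can be compared directly,
although the sources and targets are only propositionally equal. -/
theorem Adj.functor_ext {G₁ G₂ : CrMod.{u}} {F F' : Adj G₁ ⥤ Adj G₂}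
    (hobj : ∀ a, F.obj a = F'.obj a)
    (hmap : ∀ {a b : Adj G₁} (χ : a ⟶ b) (x : G₂.f),
      Adj.homCLM (F.map χ) x = Adj.homCLM (F'.map χ) x) : F = F' :=
  CategoryTheory.Functor.ext hobj fun a b χ => Adj.hom_ext fun x => by simp [hmap]

namespace SecButterfly

variable {G₁ G₂ G₃ : CrMod.{u}}

/-! ### Identities and composites of butterflies: the maps `Φ⁻¹`, the objects, the functors. -/

theorem id_Φ_symm {G : CrMod.{u}} (x : G.f) : (SecButterfly.id G).Φ.symm x = x := by
  obtain ⟨X, rfl⟩ := G.p_surjective x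
  -- The element `(0, X)` lies over `X` under both `r₁` and `r₂`, the latter because `r₂ (0, X) = t
  -- 0 + X`.
  have h := (SecButterfly.id G).Φ_symm_p_r₂ (Butterfly.sd 0 X)
  change (SecButterfly.id G).Φ.symm (G.p (G.t 0 + X)) = G.p X at h
  rwa [map_zero, zero_add] at h

/-- Every point of `𝔣₃` comes from a class `[a, b]` with `r₂ a = r₁' b`. Along such a class both
sides walk from `r₂' b` to `r₁ a`: the composite in one step, the two factors through the common
element of `𝔤₂`. -/
theorem comp_Φ_symm (S : SecButterfly G₁ G₂) (S' : SecButterfly G₂ G₃) (x : G₃.f) :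
    (S.comp S').Φ.symm x = S.Φ.symm (S'.Φ.symm x) := by
  obtain ⟨X, rfl⟩ := G₃.p_surjective x
  obtain ⟨k, rfl⟩ := (S.comp S').exists_r₂ X
  obtain ⟨a, b, h, rfl⟩ := Butterfly.exists_cls k
  refine ((S.comp S').Φ_symm_p_r₂ _).trans ?_
  change G₁.p (S.B.r₁ a) = S.Φ.symm (S'.Φ.symm (G₃.p (S'.B.r₂ b)))
  rw [Φ_symm_p_r₂, ← h, Φ_symm_p_r₂]

theorem adjObj_id {G : CrMod.{u}} (a : Adj G) : (SecButterfly.id G).adjObj a = a := by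
  refine Adj.ext (fun x => ?_) fun X Y => ?_
  · rw [adjObj_s, id_Φ_symm, id_φ]
  -- With the lifts `(0, X)` and `(0, Y)` the correction `j [x, y]` vanishes: the bracket is `(0,
  -- [X, Y])` and `j` is the first component.
  · have h := (SecButterfly.id G).adjObj_η a (Butterfly.sd 0 X) (Butterfly.sd 0 Y)
    have hj : (SecButterfly.id G).j (Butterfly.sd (⁅(0 : G.h), (0 : G.h)⁆ + G.α X 0 - G.α Y 0)
        ⁅X, Y⁆) = 0 := by
      rw [id_j]; simp
    change ((SecButterfly.id G).adjObj a).η.toLin (G.t 0 + X) (G.t 0 + Y) =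
      (SecButterfly.id G).f (a.η.toLin X Y) + (SecButterfly.id G).j (Butterfly.sd
        (⁅(0 : G.h), (0 : G.h)⁆ + G.α X 0 - G.α Y 0) ⁅X, Y⁆) at h
    rwa [hj, id_f, map_zero, zero_add, zero_add, add_zero] at h

/-- For classes `[x, y]` and `[x', y']`, both sides equal `f' f η (r₁ x, r₁ x') + f' j [x, x'] + j'
[y, y']`. On the left the last two terms are the retraction of the composite, on the right they are
the corrections collected by applying `adjObj_η` twice. -/
theorem adjObj_comp (S : SecButterfly G₁ G₂) (S' : SecButterfly G₂ G₃) (a : Adj G₁) :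
    (S.comp S').adjObj a = S'.adjObj (S.adjObj a) := by
  refine Adj.ext (fun x => ?_) fun X Y => ?_
  · rw [adjObj_s, adjObj_s, adjObj_s, comp_Φ_symm, comp_φ]
  · obtain ⟨k, rfl⟩ := (S.comp S').exists_r₂ X
    obtain ⟨l, rfl⟩ := (S.comp S').exists_r₂ Y
    rw [adjObj_η]
    obtain ⟨x, y, h, rfl⟩ := Butterfly.exists_cls k
    obtain ⟨x', y', h', rfl⟩ := Butterfly.exists_cls l
    have hj : (S.comp S').j (Butterfly.cls S.B S'.B ⁅Butterfly.pair S.B S'.B x y h,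
        Butterfly.pair S.B S'.B x' y' h'⁆) = S'.f (S.j ⁅x, x'⁆) + S'.j ⁅y, y'⁆ := by
      rw [comp_j, LCLieHom.map_lie, LCLieHom.map_lie, map_sub, f_apply, sub_eq_neg_add]
      rfl
    refine (congrArg (_ + ·) hj).trans ?_
    rw [comp_f]
    -- The map `r₂` of the composite sends `[x, y]` to `r₂' y`, which gives the right side the shape
    -- required by `adjObj_η` for `S'`. The fibre product conditions `r₂ x = r₁' y` and `r₂ x' = r₁'
    -- y'` then permit the second application, for `S`.
    change S'.f (S.f (a.η.toLin (S.B.r₁ x) (S.B.r₁ x'))) + _ =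
      (S'.adjObj (S.adjObj a)).η.toLin (S'.B.r₂ y) (S'.B.r₂ y')
    rw [adjObj_η, ← h, ← h', adjObj_η, map_add, add_assoc]

theorem adjFunctor_id (G : CrMod.{u}) : (SecButterfly.id G).adjFunctor = 𝟭 (Adj G) :=
  Adj.functor_ext adjObj_id fun χ x => by
    refine (homCLM_adjMap (SecButterfly.id G) χ x).trans ?_
    rw [id_f, id_Φ_symm]
    rfl

theorem adjFunctor_comp (S : SecButterfly G₁ G₂) (S' : SecButterfly G₂ G₃) :
    (S.comp S').adjFunctor = S.adjFunctor ⋙ S'.adjFunctor :=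
  Adj.functor_ext (adjObj_comp S S') fun χ x => by
    refine (homCLM_adjMap (S.comp S') χ x).trans ?_
    rw [comp_f, comp_Φ_symm]
    rfl

end SecButterfly

/-! ### Natural transformations between functors of adjustments -/

namespace Adj

variable {G₁ G₂ G₃ : CrMod.{u}}

/-- The continuous linear map underlying a component of a 2-morphism of `Grpd`. -/
def appCLM {F F' : Grpd.of (Adj G₁) ⟶ Grpd.of (Adj G₂)} (τ : F ⟶ F') (a : Adj G₁) :
    G₂.f →L[ℝ] G₂.h :=
  homCLM (NatTrans.app τ a)

section

variable {F F' F'' : Grpd.of (Adj G₁) ⟶ Grpd.of (Adj G₂)}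

/-- This reduces every coherence law below to an identity of vectors in `𝔥₂`. -/
theorem nat_ext {τ τ' : F ⟶ F'} (h : ∀ a x, appCLM τ a x = appCLM τ' a x) : τ = τ' :=
  NatTrans.ext (funext fun a => hom_ext (h a))

theorem appCLM_comp (τ : F ⟶ F') (τ' : F' ⟶ F'') (a : Adj G₁) (x : G₂.f) :
    appCLM (τ ≫ τ') a x = appCLM τ a x + appCLM τ' a x := rfl

theorem appCLM_eqToHom (h : F = F') (a : Adj G₁) (x : G₂.f) :
    appCLM (eqToHom h) a x = 0 := by
  subst h; rfl

end

open Bicategory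

/-- The structural 2-morphisms of the 2-category of groupoids have identity components, hence vanish
after passing to linear maps. -/
theorem appCLM_leftUnitor (F : Grpd.of (Adj G₁) ⟶ Grpd.of (Adj G₂)) (a : Adj G₁) (x : G₂.f) :
    appCLM (λ_ F).hom a x = 0 := rfl

theorem appCLM_rightUnitor (F : Grpd.of (Adj G₁) ⟶ Grpd.of (Adj G₂)) (a : Adj G₁) (x : G₂.f) :
    appCLM (ρ_ F).hom a x = 0 := rfl

theorem appCLM_associator {G₄ : CrMod.{u}} (F : Grpd.of (Adj G₁) ⟶ Grpd.of (Adj G₂))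
    (F' : Grpd.of (Adj G₂) ⟶ Grpd.of (Adj G₃)) (F'' : Grpd.of (Adj G₃) ⟶ Grpd.of (Adj G₄))
    (a : Adj G₁) (x : G₄.f) : appCLM (α_ F F' F'').hom a x = 0 := rfl

end Adj

/-! ### The strict pseudofunctor -/

section

open Bicategory

variable {G₁ G₂ G₃ G₄ : CrMod.{u}}

/-! ### Linear maps underlying the images of whiskerings and coherence 2-morphisms. -/

theorem appCLM_adjSec {S S' : G₁ ⟶ G₂} (σ : S ⟶ S') (a : Adj G₁) (x : G₂.f) :
    Adj.appCLM (adjSec.map₂ σ) a x = SecButterfly.γ σ (a.s ((SecButterfly.Φ S).symm x)) := rfl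

/-- The factor `φ` in `γ (S ◁ σ) = γ σ ∘ φ` is the one that appears when the component of `σ` is
taken at the pushed-forward object, whose section is `φ s Φ⁻¹`. -/
theorem appCLM_adjSec_whiskerLeft (S : G₁ ⟶ G₂) {S' S'' : G₂ ⟶ G₃} (σ : S' ⟶ S'') (a : Adj G₁)
    (x : G₃.f) : Adj.appCLM (adjSec.map₂ (S ◁ σ)) a x =
      Adj.appCLM (adjSec.map S ◁ adjSec.map₂ σ) a x := by
  refine (SecButterfly.γ_whiskerLeft S σ _).trans ?_
  change _ = SecButterfly.γ σ (SecButterfly.φ S (a.s ((SecButterfly.Φ S).symm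
    ((SecButterfly.Φ S').symm x))))
  exact congrArg (fun z => SecButterfly.γ σ (SecButterfly.φ S (a.s z)))
    (SecButterfly.comp_Φ_symm S S' x)

/-- The factor `f` in `γ (σ ▷ S'') = f ∘ γ σ` is the one by which the functor of `S''` acts on
morphisms. -/
theorem appCLM_adjSec_whiskerRight {S S' : G₁ ⟶ G₂} (σ : S ⟶ S') (S'' : G₂ ⟶ G₃) (a : Adj G₁)
    (x : G₃.f) : Adj.appCLM (adjSec.map₂ (σ ▷ S'')) a x =
      Adj.appCLM (adjSec.map₂ σ ▷ adjSec.map S'') a x := by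
  refine (SecButterfly.γ_whiskerRight σ S'' _).trans ?_
  change _ = SecButterfly.f S'' (SecButterfly.γ σ (a.s ((SecButterfly.Φ S).symm
    ((SecButterfly.Φ S'').symm x))))
  exact congrArg (fun z => SecButterfly.f S'' (SecButterfly.γ σ (a.s z)))
    (SecButterfly.comp_Φ_symm S S'' x)

/-- Unitors and associators of butterflies match the chosen sections exactly. This is why the
coherence 2-morphisms of the pseudofunctor can be identities. -/
theorem γ_leftUnitor (S : G₁ ⟶ G₂) (X : G₁.g) : SecButterfly.γ (λ_ S).hom X = 0 :=
  SecButterfly.γ_leftUnitor_hom S X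

theorem γ_rightUnitor (S : G₁ ⟶ G₂) (X : G₁.g) : SecButterfly.γ (ρ_ S).hom X = 0 :=
  SecButterfly.γ_rightUnitor_hom S X

theorem γ_associator (S : G₁ ⟶ G₂) (S' : G₂ ⟶ G₃) (S'' : G₃ ⟶ G₄) (X : G₁.g) :
    SecButterfly.γ (α_ S S' S'').hom X = 0 :=
  SecButterfly.γ_assoc_hom S S' S'' X

/-- The groupoids of adjustments, their functors and natural transformations form a prelax
functor. -/
noncomputable def adjPrelax : PrelaxFunctor CrMod.{u} Grpd.{u, u} where
  toPrelaxFunctorStruct := adjSec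
  map₂_id S := Adj.nat_ext fun a x => SecButterfly.γ_id _
  map₂_comp σ τ := Adj.nat_ext fun a x => by
    refine (SecButterfly.γ_comp σ τ _).trans ?_
    refine Eq.trans ?_ (Adj.appCLM_comp _ _ a x).symm
    -- The component of `τ` is formed with `Φ` of the middle butterfly. It agrees with `Φ` of the
    -- first one because they are linked by `σ`.
    rw [appCLM_adjSec, appCLM_adjSec, ← SecButterfly.Φ_eq σ]
    rfl

theorem adjSec_map_id (G : CrMod.{u}) : adjSec.map (𝟙 G) = 𝟙 (adjSec.obj G) :=
  SecButterfly.adjFunctor_id G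

theorem adjSec_map_comp (S : G₁ ⟶ G₂) (S' : G₂ ⟶ G₃) :
    adjSec.map (S ≫ S') = adjSec.map S ≫ adjSec.map S' :=
  SecButterfly.adjFunctor_comp S S'

/-- The strict pseudofunctor of adjustments. -/
noncomputable def adjStrict : StrictPseudofunctor CrMod.{u} Grpd.{u, u} :=
  StrictPseudofunctor.mk'
    { toPrelaxFunctor := adjPrelax
      map_id := adjSec_map_id
      map_comp := adjSec_map_comp
      map₂_whisker_left := fun S _ _ σ => Adj.nat_ext fun a x => by
        refine (appCLM_adjSec_whiskerLeft S σ a x).trans ?_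
        refine Eq.trans ?_ (Adj.appCLM_comp _ _ a x).symm
        -- The whiskered 2-morphism is flanked by two transports along the strict equalities of
        -- composites, so its linear map is `0 + (_ + 0)`.
        refine Eq.trans ?_ (congrArg₂ (· + ·) (Adj.appCLM_eqToHom _ a x)
          (Adj.appCLM_comp _ _ a x)).symm
        refine Eq.trans ?_ (congrArg (fun z => 0 + (_ + z)) (Adj.appCLM_eqToHom _ a x)).symm
        rw [add_zero, zero_add]
        rfl
      map₂_whisker_right := fun σ S => Adj.nat_ext fun a x => by
        refine (appCLM_adjSec_whiskerRight σ S a x).trans ?_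
        refine Eq.trans ?_ (Adj.appCLM_comp _ _ a x).symm
        refine Eq.trans ?_ (congrArg₂ (· + ·) (Adj.appCLM_eqToHom _ a x)
          (Adj.appCLM_comp _ _ a x)).symm
        refine Eq.trans ?_ (congrArg (fun z => 0 + (_ + z)) (Adj.appCLM_eqToHom _ a x)).symm
        rw [add_zero, zero_add]
        rfl
      map₂_left_unitor := fun S => Adj.nat_ext fun a x => by
        refine (γ_leftUnitor S _).trans ?_
        refine Eq.trans ?_ (Adj.appCLM_comp _ _ a x).symm
        exact ((congrArg₂ (· + ·) (Adj.appCLM_eqToHom _ a x)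
          (Adj.appCLM_leftUnitor _ a x)).trans (add_zero _)).symm
      map₂_right_unitor := fun S => Adj.nat_ext fun a x => by
        refine (γ_rightUnitor S _).trans ?_
        refine Eq.trans ?_ (Adj.appCLM_comp _ _ a x).symm
        exact ((congrArg₂ (· + ·) (Adj.appCLM_eqToHom _ a x)
          (Adj.appCLM_rightUnitor _ a x)).trans (add_zero _)).symm
      map₂_associator := fun S S' S'' => Adj.nat_ext fun a x => by
        refine (γ_associator S S' S'' _).trans ?_
        refine Eq.trans ?_ (Adj.appCLM_comp _ _ a x).symm
        -- All three factors, the associator of functors and the transports around it, contribute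
        -- zero, as does `γ` of the associator of butterflies.
        refine Eq.trans ?_ (congrArg₂ (· + ·) (Adj.appCLM_eqToHom _ a x)
          (Adj.appCLM_comp _ _ a x)).symm
        refine Eq.trans ?_ (congrArg₂ (fun z w => 0 + (z + w)) (Adj.appCLM_associator _ _ _ a x)
          (Adj.appCLM_eqToHom _ a x)).symm
        rw [add_zero, zero_add] }

end

/-! ### Invertible butterflies induce equivalences -/

namespace SecButterfly

variable {G₁ G₂ : CrMod.{u}}

/-- The inverse of an invertible butterfly, with a section of `r₂`. -/
def flip (S : SecButterfly G₁ G₂) (q : G₂.g →L[ℝ] S.B.k) (hq : ∀ X, S.B.r₂ (q X) = X) :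
    SecButterfly G₂ G₁ where
  B :=
    { k := S.B.k
      i₁ := S.B.i₂
      i₂ := S.B.i₁
      r₁ := S.B.r₂
      r₂ := S.B.r₁
      r₁_i₁ := S.B.r₂_i₂
      r₂_i₂ := S.B.r₁_i₁
      r₂_i₁ := S.B.r₁_i₂
      exact := S.invertible
      i₁_α := S.B.i₂_α
      i₂_α := S.B.i₁_α }
  invertible := S.B.exact
  q := q
  r₁_q := hq

variable (S : SecButterfly G₁ G₂) (q : G₂.g →L[ℝ] S.B.k) (hq : ∀ X, S.B.r₂ (q X) = X)

/-! ### The maps of the reversed butterfly in terms of the original ones. -/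

theorem flip_Φ_symm (x : G₁.f) : (S.flip q hq).Φ.symm x = S.Φ x := by
  obtain ⟨X, rfl⟩ := G₁.p_surjective x
  have h := (S.flip q hq).Φ_symm_p_r₂ (S.q X)
  have h' := S.Φ_p_r₁ (S.q X)
  rw [S.r₁_q] at h'
  change (S.flip q hq).Φ.symm (G₁.p (S.B.r₁ (S.q X))) = G₂.p (S.B.r₂ (S.q X)) at h
  rw [S.r₁_q] at h
  exact h.trans h'.symm

theorem i₁_flip_j (x : S.B.k) : S.B.i₁ ((S.flip q hq).j x) = x - q (S.B.r₂ x) :=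
  eq_sub_of_add_eq ((S.flip q hq).i₂_j x)

/-- Since `f = -j i₁`, applying `-j` to the splitting `i₁ j' + q r₂ = id`, with `j'` the reversed
retraction, eliminates `j'`. -/
theorem f_flip_j (x : S.B.k) : S.f ((S.flip q hq).j x) = S.j (q (S.B.r₂ x)) - S.j x := by
  rw [f_apply, i₁_flip_j, map_sub, neg_sub]

/-- The two maps `f` are inverse to each other up to `j q t`. On a difference of sections `t φ = s'
- s` this error becomes the difference of the maps `j q s`, which makes `j q s` natural. -/
theorem f_flip_f (y : G₂.h) : S.f ((S.flip q hq).f y) = y - S.j (q (G₂.t y)) := by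
  rw [f_apply (S.flip q hq), map_neg]
  refine (congrArg Neg.neg (S.f_flip_j q hq (S.B.i₂ y))).trans ?_
  rw [S.B.r₂_i₂, j_i₂, neg_sub]

/-- The component at `(s, η)` of the comparison between the identity and the composition of the
functors associated to a butterfly and its inverse. -/
noncomputable def flipApp (a : Adj G₂) : S.adjObj ((S.flip q hq).adjObj a) ⟶ a :=
  Adj.Hom.mk (S.j.comp (q.comp a.s))
    (fun x => by
      rw [adjObj_s, adjObj_s, flip_Φ_symm, ContinuousLinearEquiv.apply_symm_apply]
      -- The round trip sends `s` to `r₂ q₁ r₁ q s`, with `q₁` the section of `S`. Splitting `q (s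
      -- x)` in `𝔨` shows that it differs from `s` by `t j q s`.
      have h := S.r₂_eq (q (a.s x))
      rw [hq] at h
      exact sub_eq_of_eq_add' h)
    (fun X Y => by
      obtain ⟨x, rfl⟩ := S.exists_r₂ X
      obtain ⟨y, rfl⟩ := S.exists_r₂ Y
      have h : ((S.flip q hq).adjObj a).η.toLin (S.B.r₁ x) (S.B.r₁ y) =
          (S.flip q hq).f (a.η.toLin (S.B.r₂ x) (S.B.r₂ y)) +
            (S.flip q hq).j (show S.B.k from ⁅x, y⁆) :=
        (S.flip q hq).adjObj_η a x y
      -- The two terms `j [x, y]` cancel. Adaptedness replaces `t η` by the bracket minus `s p` of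
      -- the bracket, so only `j q s p` of the bracket survives.
      rw [adjObj_η, h, map_add, f_flip_f, f_flip_j, a.adapted, LCLieHom.map_lie, map_sub, map_sub]
      change _ = -S.j (q (a.s (G₂.p ⁅S.B.r₂ x, S.B.r₂ y⁆)))
      abel)

/-- The functor of a butterfly, precomposed with that of its inverse, is isomorphic to the
identity. -/
noncomputable def flipIso : (S.flip q hq).adjFunctor ⋙ S.adjFunctor ≅ 𝟭 (Adj G₂) :=
  NatIso.ofComponents (fun a => Groupoid.isoEquivHom _ _ |>.symm (S.flipApp q hq a))
    fun {a b} χ => Adj.hom_ext fun x => by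
      refine (Adj.homCLM_comp _ _ _).trans (Eq.trans ?_ (Adj.homCLM_comp _ _ _).symm)
      change S.f ((S.flip q hq).f (Adj.homCLM χ ((S.flip q hq).Φ.symm (S.Φ.symm x)))) +
        S.j (q (b.s x)) = S.j (q (a.s x)) + Adj.homCLM χ x
      rw [flip_Φ_symm, ContinuousLinearEquiv.apply_symm_apply, f_flip_f, Adj.t_homCLM, map_sub,
        map_sub]
      abel

/-- The functor associated to an invertible butterfly with a section is an equivalence. -/
noncomputable def adjEquivalence : Adj G₁ ≌ Adj G₂ :=
  CategoryTheory.Equivalence.mk S.adjFunctor (S.flip S.sec₂ S.r₂_sec₂).adjFunctor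
    -- Reversing twice, with the original section `S.q`, returns `S` definitionally. Hence the unit
    -- is the same construction applied to the reversed butterfly.
    ((S.flip S.sec₂ S.r₂_sec₂).flipIso S.q S.r₁_q).symm (S.flipIso S.sec₂ S.r₂_sec₂)

end SecButterfly

theorem mainTheorem7 :
    (∃ F : StrictPseudofunctor CrMod.{u} Grpd.{u, u}, F.toPrelaxFunctorStruct = adjSec) ∧
      ∀ G₁ G₂ : CrMod.{u}, WeaklyEquivalent G₁ G₂ → Nonempty (Adj G₁ ≌ Adj G₂) := by
  -- The underlying data agree by construction, since `adjStrict` is built on `adjSec`.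
  refine ⟨⟨adjStrict, rfl⟩, fun G₁ G₂ ⟨B, hB⟩ => ?_⟩
  -- Weak equivalence provides no section of `r₁`; any one supplied by short exactness will do.
  obtain ⟨q, hq⟩ := B.exact.2.2
  exact ⟨SecButterfly.adjEquivalence ⟨B, hB, q, hq⟩⟩
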